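/- An instance $I$ of high-multiplicity scheduling on unrelated machines consists of $\tau,\kappa\in\mathbb N$ and vectors of natural numbers (zero allowed) $n=(n_j)_{j\le\tau}$, $m=(m_i)_{i\le\kappa}$, $p=(p^i_j)_{i\le\kappa,\,j\le\tau}$, $w=(w_j)_{j\le\tau}$: there are $n_j$ jobs of type $j$, each of weight $w_j$, and $m_i$ machines of kind $i$, and a job of type $j$ takes time $p^i_j$ on a machine of kind $i$. A schedule assigns to each job a machine and a closed interval in $[0,\infty)$ whose length is its processing time on that machine, such that intervals on the same machine overlap at most in endpoints; the completion time of a job is the right endpoint of its interval. The decision problem $R|HM|C_{\max}$ asks, given $I$ and $k\in\mathbb N$, whether some schedule completes all jobs by time $k$; the decision problem $R|HM|\sum w_jC_j$ asks whether some schedule has total weighted completion time at most $k$. Numbers are written in binary, $\langle a\rangle=1+\lceil\log_2(a+1)\rceil$ for $a\in\mathbb N$, the length $\langle v\rangle$ of a vector is the sum of the lengths of its entries, and $\langle I\rangle=\langle n,m,p,w\rangle$. **Lemma.** The decision problems $R|HM|C_{\max}$ and $R|HM|\sum w_jC_j$ belong to $\mathsf{NP}$. Moreover, yes-instances have certificates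 that are short multisets of extended configurations, in the following sense. For a configuration $c\in\mathbb N^\tau$ let $f^i(c)$ be the total weighted completion time of $c_j$ jobs of type $j$ ($j\le\tau$) processed without idle time from time $0$ on a single machine of kind $i$ in the order of non-increasing Smith ratio $w_j/p^i_j$ (a ratio with $p^i_j=0$ is read as $+\infty$). Let $e_i\in\mathbb N^\kappa$ be the $i$-th unit vector, and put $$X_{C_{\max}}(k)=\Big\{(c,e_i) : i\le\kappa,\ c\in\mathbb N^\tau,\ \textstyle\sum_j p^i_jc_j\le k\Big\},\qquad X_{\Sigma}(k)=\big\{(c,F,e_i) : i\le\kappa,\ c\le n,\ f^i(c)\le F\le k\big\}.$$ Say that a vector $b$ of natural numbers has a $B$-short decomposition over a set $X$ if $b=\sum_{x\in X}\lambda_x x$ with $\lambda_x\in\mathbb N$, at most $\langle b\rangle$ of the $\lambda_x$ nonzero, and $\sum_{x:\lambda_x\ne0}(\langle x\rangle+\langle\lambda_x\rangle)\le B$. Then there is a polynomial $q$ such that for all $I$ and $k$: 1. $(I,k)$ is a yes-instance of $R|HM|C_{\max}$ if and only if $(n,m)$ has a $q(\langle I\rangle)$-short decomposition over $X_{C_{\max}}(k)$.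 2. If there is at least one machine, then $(I,k)$ is a yes-instance of $R|HM|\sum w_jC_j$ if and only if $(n,k,m)$ has a $q(\langle I\rangle+\langle k\rangle)$-short decomposition over $X_{\Sigma}(k)$. 3. $(I,k)$ is a yes-instance of $R|HM|\sum w_jC_j$ if and only if, for some $k'\le k$, the vector $(n,k',m)$ has a $q(\langle I\rangle)$-short decomposition over $X_{\Sigma}(k')$. -/

import Mathlib

open scoped BigOperators

/-! ### Binary encoding length -/

/-- Binary encoding length `1 + ⌈log₂ (a + 1)⌉` of a natural number
(`Nat.size a` is the number of binary digits of `a`, with `Nat.size 0 = 0`). -/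
def bitLen (a : ℕ) : ℕ := Nat.size a + 1

/-- Encoding length of a finite sequence of natural numbers. -/
def listLen (x : List ℕ) : ℕ := (x.map bitLen).sum

/-- Encoding length of a vector of natural numbers. -/
def vecLen {ι : Type} [Fintype ι] (v : ι → ℕ) : ℕ := ∑ i, bitLen (v i)

/-! ### Random access machines with logarithmic cost

Programs of a random access machine on natural numbers, with structured control flow. The memory
consists of arrays; an array is named by a constant of the program (so a program uses finitely many
of them) and is addressed indirectly, by a computed index. Every elementary operation is charged
the binary lengths of all addresses, operands and results involved. This is the logarithmic-cost
RAM, which is polynomially equivalent to Turing machines. -/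

namespace RAM

/-- Memory: `s a i` is the content of cell `i` of the array `a`. -/
abbrev Store : Type := ℕ → ℕ → ℕ

/-- Arithmetic expressions. `sub` is truncated subtraction, `read a e` is the content of the cell
of the array `a` whose index is the value of `e`. -/
inductive Expr : Type
  | const (n : ℕ) : Expr
  | read (a : ℕ) (e : Expr) : Expr
  | add (e₁ e₂ : Expr) : Expr
  | sub (e₁ e₂ : Expr) : Expr
  | mul (e₁ e₂ : Expr) : Expr

/-- Value of an expression. -/
def Expr.eval (s : Store) : Expr → ℕ
  | .const n => n
  | .read a e => s a (e.eval s)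
  | .add e₁ e₂ => e₁.eval s + e₂.eval s
  | .sub e₁ e₂ => e₁.eval s - e₂.eval s
  | .mul e₁ e₂ => e₁.eval s * e₂.eval s

/-- Logarithmic cost of evaluating an expression: the sum of the binary lengths of the values of
all its subexpressions (the index of a `read` is one of them). -/
def Expr.cost (s : Store) : Expr → ℕ
  | .const n => bitLen n
  | .read a e => e.cost s + bitLen (s a (e.eval s))
  | .add e₁ e₂ => e₁.cost s + e₂.cost s + bitLen (e₁.eval s + e₂.eval s)
  | .sub e₁ e₂ => e₁.cost s + e₂.cost s + bitLen (e₁.eval s - e₂.eval s)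
  | .mul e₁ e₂ => e₁.cost s + e₂.cost s + bitLen (e₁.eval s * e₂.eval s)

/-- Programs. `write a e₁ e₂` stores the value of `e₂` in the cell of the array `a` whose index is
the value of `e₁`; `cond e c₁ c₂` runs `c₁` if `e` is nonzero and `c₂` otherwise; `loop e c` runs
`c` as long as `e` is nonzero. -/
inductive Prog : Type
  | skip : Prog
  | write (a : ℕ) (e₁ e₂ : Expr) : Prog
  | seq (c₁ c₂ : Prog) : Prog
  | cond (e : Expr) (c₁ c₂ : Prog) : Prog
  | loop (e : Expr) (c : Prog) : Prog

/-- `Exec c s t s'`: started in the memory `s`, the program `c` halts after time exactly `t`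
(logarithmic cost) in the memory `s'`. -/
inductive Exec : Prog → Store → ℕ → Store → Prop
  | skip (s : Store) : Exec .skip s 1 s
  | write (a : ℕ) (e₁ e₂ : Expr) (s : Store) :
      Exec (.write a e₁ e₂) s (e₁.cost s + e₂.cost s + 1)
        (Function.update s a (Function.update (s a) (e₁.eval s) (e₂.eval s)))
  | seq {c₁ c₂ : Prog} {s s₁ s₂ : Store} {t₁ t₂ : ℕ} :
      Exec c₁ s t₁ s₁ → Exec c₂ s₁ t₂ s₂ → Exec (.seq c₁ c₂) s (t₁ + t₂) s₂
  | cond_true {e : Expr} {c₁ c₂ : Prog} {s s₁ : Store} {t : ℕ} :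
      e.eval s ≠ 0 → Exec c₁ s t s₁ → Exec (.cond e c₁ c₂) s (e.cost s + 1 + t) s₁
  | cond_false {e : Expr} {c₁ c₂ : Prog} {s s₁ : Store} {t : ℕ} :
      e.eval s = 0 → Exec c₂ s t s₁ → Exec (.cond e c₁ c₂) s (e.cost s + 1 + t) s₁
  | loop_done {e : Expr} {c : Prog} {s : Store} :
      e.eval s = 0 → Exec (.loop e c) s (e.cost s + 1) s
  | loop_step {e : Expr} {c : Prog} {s s₁ s₂ : Store} {t₁ t₂ : ℕ} :
      e.eval s ≠ 0 → Exec c s t₁ s₁ → Exec (.loop e c) s₁ t₂ s₂ →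
        Exec (.loop e c) s (e.cost s + 1 + t₁ + t₂) s₂

/-- The machine is deterministic: running time and final memory are unique. -/
theorem Exec.det {c : Prog} {s s₁ : Store} {t₁ : ℕ} (h : Exec c s t₁ s₁) :
    ∀ {t₂ : ℕ} {s₂ : Store}, Exec c s t₂ s₂ → t₁ = t₂ ∧ s₁ = s₂ := by
  induction h with
  | skip s => intro _ _ h; cases h; exact ⟨rfl, rfl⟩
  | write a e₁ e₂ s => intro _ _ h; cases h; exact ⟨rfl, rfl⟩
  | seq _ _ ih₁ ih₂ =>
    intro _ _ h
    cases h with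
    | seq h₁ h₂ =>
      obtain ⟨rfl, rfl⟩ := ih₁ h₁
      obtain ⟨rfl, rfl⟩ := ih₂ h₂
      exact ⟨rfl, rfl⟩
  | cond_true he _ ih =>
    intro _ _ h
    cases h with
    | cond_true _ h => obtain ⟨rfl, rfl⟩ := ih h; exact ⟨rfl, rfl⟩
    | cond_false h₀ _ => exact absurd h₀ he
  | cond_false he _ ih =>
    intro _ _ h
    cases h with
    | cond_true h₀ _ => exact absurd he h₀
    | cond_false _ h => obtain ⟨rfl, rfl⟩ := ih h; exact ⟨rfl, rfl⟩
  | loop_done he =>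
    intro _ _ h
    cases h with
    | loop_done _ => exact ⟨rfl, rfl⟩
    | loop_step h₀ _ _ => exact absurd he h₀
  | loop_step he _ _ ih₁ ih₂ =>
    intro _ _ h
    cases h with
    | loop_done h₀ => exact absurd h₀ he
    | loop_step _ h₁ h₂ =>
      obtain ⟨rfl, rfl⟩ := ih₁ h₁
      obtain ⟨rfl, rfl⟩ := ih₂ h₂
      exact ⟨rfl, rfl⟩

/-- An array holding a finite sequence: its length in cell `0`, its entries in the cells
`1, 2, …`, and zeros behind them. -/
def listCells (x : List ℕ) : ℕ → ℕ := fun i => (x.length :: x).getD i 0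

/-- Initial memory for the two inputs `x` (array `0`) and `y` (array `1`); the rest is zero. -/
def initStore (x y : List ℕ) : Store := fun a =>
  if a = 0 then listCells x else if a = 1 then listCells y else fun _ => 0

/-- On the inputs `x` and `y`, the program halts with the answer `1` in cell `0` of array `2`. -/
def Accepts (V : Prog) (x y : List ℕ) : Prop :=
  ∃ (t : ℕ) (s : Store), Exec V (initStore x y) t s ∧ s 2 0 = 1

/-- On all inputs `x`, `y`, the program halts in time at most `p` of the total input length. -/
def RunsInTime (V : Prog) (p : Polynomial ℕ) : Prop :=
  ∀ x y : List ℕ, ∃ (t : ℕ) (s : Store),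
    Exec V (initStore x y) t s ∧ t ≤ p.eval (listLen x + listLen y)

end RAM

/-- The class NP, for decision problems whose inputs are finite sequences of natural numbers written
in binary: there are a verifier that always halts in polynomial time and a polynomial length bound
`q`, such that the yes-instances are the inputs `x` with an accepted certificate of length at
most `q` of the length of `x`. -/
def InNP (L : Set (List ℕ)) : Prop :=
  ∃ (V : RAM.Prog) (p q : Polynomial ℕ), RAM.RunsInTime V p ∧
    ∀ x : List ℕ, x ∈ L ↔ ∃ y : List ℕ, listLen y ≤ q.eval (listLen x) ∧ RAM.Accepts V x y

/-! ### High-multiplicity scheduling on unrelated machines -/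

/-- A high-multiplicity instance with `τ` job types and `κ` machine kinds: there are `n j` jobs of
type `j`, of weight `w j` each, and `m i` machines of kind `i`; a job of type `j` has processing
time `p i j` on a machine of kind `i`. -/
structure HMInstance where
  τ : ℕ
  κ : ℕ
  n : Fin τ → ℕ
  m : Fin κ → ℕ
  p : Fin κ → Fin τ → ℕ
  w : Fin τ → ℕ

namespace HMInstance

/-- The individual jobs. -/
abbrev Job (I : HMInstance) : Type := (j : Fin I.τ) × Fin (I.n j)

/-- The individual machines. -/
abbrev Machine (I : HMInstance) : Type := (i : Fin I.κ) × Fin (I.m i)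

/-- A schedule assigns to each job a machine and a closed time interval, which starts at a
nonnegative time and has the length of the processing time of the job on that machine;
intervals on the same machine do not overlap except for endpoints. -/
structure Schedule (I : HMInstance) where
  machine : I.Job → I.Machine
  start : I.Job → ℝ
  start_nonneg : ∀ a, 0 ≤ start a
  no_overlap : ∀ a b, a ≠ b → machine a = machine b →
    start a + (I.p (machine a).1 a.1 : ℝ) ≤ start b ∨
      start b + (I.p (machine b).1 b.1 : ℝ) ≤ start a

/-- Completion time `C_a` of the job `a`: the right endpoint of its interval. -/
def Schedule.completion {I : HMInstance} (S : I.Schedule) (a : I.Job) : ℝ :=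
  S.start a + (I.p (S.machine a).1 a.1 : ℝ)

/-- `(I, k)` is a yes-instance of `R|HM|C_max`: in some schedule all jobs are completed by
time `k`. -/
def CmaxYes (I : HMInstance) (k : ℕ) : Prop :=
  ∃ S : I.Schedule, ∀ a : I.Job, S.completion a ≤ (k : ℝ)

/-- `(I, k)` is a yes-instance of `R|HM|∑ w_j C_j`: some schedule has total weighted completion time
at most `k`. -/
def SumWCYes (I : HMInstance) (k : ℕ) : Prop :=
  ∃ S : I.Schedule, ∑ a : I.Job, (I.w a.1 : ℝ) * S.completion a ≤ (k : ℝ)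

/-- Encoding length `⟨n, m, p, w⟩` of an instance. -/
def len (I : HMInstance) : ℕ :=
  vecLen I.n + vecLen I.m + (∑ i, vecLen (I.p i)) + vecLen I.w

/-- The instance `I` together with the bound `k`, as a sequence of numbers:
`τ, κ, n, m, p¹, …, p^κ, w, k`. -/
def encode (I : HMInstance) (k : ℕ) : List ℕ :=
  [I.τ, I.κ] ++ List.ofFn I.n ++ List.ofFn I.m ++
    (List.ofFn fun i => List.ofFn (I.p i)).flatten ++ List.ofFn I.w ++ [k]

/-- The decision version of `R|HM|C_max`. -/
def CmaxProblem : Set (List ℕ) := {x | ∃ (I : HMInstance) (k : ℕ), x = I.encode k ∧ I.CmaxYes k}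

/-- The decision version of `R|HM|∑ w_j C_j`. -/
def SumWCProblem : Set (List ℕ) := {x | ∃ (I : HMInstance) (k : ℕ), x = I.encode k ∧ I.SumWCYes k}

/-! ### Extended configurations -/

/-- Smith ratio `w_j / p_j^i`, infinite for processing time zero. -/
def smithRatio (I : HMInstance) (i : Fin I.κ) (j : Fin I.τ) : WithTop ℚ :=
  if I.p i j = 0 then ⊤ else (((I.w j : ℚ) / (I.p i j : ℚ) : ℚ) : WithTop ℚ)

/-- Total weighted completion time on a machine of kind `i` that is free from time `t` on and
processes jobs of the listed types one after the other without idle time. -/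
def seqCost (I : HMInstance) (i : Fin I.κ) : ℕ → List (Fin I.τ) → ℕ
  | _, [] => 0
  | t, j :: l => I.w j * (t + I.p i j) + seqCost I i (t + I.p i j) l

/-- The jobs of a configuration `c`, listed by type. -/
def configJobs (I : HMInstance) (c : Fin I.τ → ℕ) : List (Fin I.τ) :=
  (List.ofFn fun j => List.replicate (c j) j).flatten

/-- The value `f^i(c)`: total weighted completion time of the jobs of the configuration `c` on a
single machine of kind `i`, scheduled by non-increasing Smith ratio. -/
def smithCost (I : HMInstance) (i : Fin I.κ) (c : Fin I.τ → ℕ) : ℕ :=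
  I.seqCost i 0
    ((I.configJobs c).insertionSort fun a b => I.smithRatio i b ≤ I.smithRatio i a)

/-- Extended configurations for `C_max`: the vectors `(c, e_i)`, where the configuration `c` takes
time at most `k` on a machine of kind `i`, and `e_i` is the `i`-th unit vector. -/
def extConfCmax (I : HMInstance) (k : ℕ) : Set (Fin I.τ ⊕ Fin I.κ → ℕ) :=
  {x | ∃ (i : Fin I.κ) (c : Fin I.τ → ℕ),
    ∑ j, I.p i j * c j ≤ k ∧ x = Sum.elim c (Pi.single i 1)}

/-- The vector `(n, m)`. -/
def targetCmax (I : HMInstance) : Fin I.τ ⊕ Fin I.κ → ℕ := Sum.elim I.n I.m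

/-- Extended configurations for `∑ w_j C_j`: the vectors `(c, F, e_i)` with `c ≤ n` and
`f^i(c) ≤ F ≤ k`. -/
def extConfSumWC (I : HMInstance) (k : ℕ) : Set (Fin I.τ ⊕ Unit ⊕ Fin I.κ → ℕ) :=
  {x | ∃ (i : Fin I.κ) (c : Fin I.τ → ℕ) (F : ℕ),
    c ≤ I.n ∧ I.smithCost i c ≤ F ∧ F ≤ k ∧
      x = Sum.elim c (Sum.elim (fun _ => F) (Pi.single i 1))}

/-- The vector `(n, k, m)`. -/
def targetSumWC (I : HMInstance) (k : ℕ) : Fin I.τ ⊕ Unit ⊕ Fin I.κ → ℕ :=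
  Sum.elim I.n (Sum.elim (fun _ => k) I.m)

end HMInstance

/-- `b` is a nonnegative integer combination `∑ λ_x x` of vectors `x ∈ X`, with at most `⟨b⟩`
distinct vectors `x` of nonzero multiplicity, where these vectors and their multiplicities have total
encoding length at most `B`. -/
def HasShortDecomposition {ι : Type} [Fintype ι] (X : Set (ι → ℕ)) (b : ι → ℕ) (B : ℕ) : Prop :=
  ∃ mult : (ι → ℕ) →₀ ℕ,
    (∀ x ∈ mult.support, x ∈ X) ∧
    (mult.sum fun x l => l • x) = b ∧
    mult.support.card ≤ vecLen b ∧
    (mult.sum fun x l => vecLen x + bitLen l) ≤ B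

/-! ### Lengths of numbers -/

/-! A schedule matters only through the configuration of each machine. For the makespan, the jobs of
a machine fit into `[0, k]` exactly when their total processing time is at most `k` (`cmaxYes_iff`).
For weighted completion times, charge each pair of jobs on a machine to the job that comes later: a
pair `a, b` costs at least `min (w a * p b) (w b * p a)`, and the Smith order attains all these
minima at once. So twice the optimal cost of a configuration is the order-free quadratic expression
`twiceCost` (`sumWCYes_iff`). Yes-instances thus correspond to writing the target vector as a sum of
extended configurations, one per machine.

There may be exponentially many machines, so this sum must be compressed. If more than `⟨b⟩`
distinct vectors occur with positive multiplicity, they have more subsets than there are vectors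
between `0` and `b`; two disjoint subsets then have equal sums, and shifting multiplicity from one
to the other removes a vector (`exists_disjoint_sum_eq`, `exists_small_combination`). The remaining
vectors and multiplicities are bounded by entries of `b`, which gives
`HasShortDecomposition.of_sum`. Conversely, a decomposition is unfolded into individual machines by
`exists_row_assignment`. Slack in the cost bound is either put on one machine or avoided by taking
`k'` to be the exact cost, whose length is polynomial in the instance alone
(`bitLen_sum_smithCost_le`).

For membership in NP, a certificate lists machine kind, multiplicity and configuration row by row.
Because `twiceCost` needs no sorting, checking it takes only arithmetic and sums bounded by the
input length. Structural induction over such terms bounds the lengths of values (`bitLen_eval_le`)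
and the running time of the compiled program (`computes_compile`). -/

theorem bitLen_pos (a : ℕ) : 1 ≤ bitLen a := Nat.le_add_left _ _

theorem bitLen_mono {a b : ℕ} (h : a ≤ b) : bitLen a ≤ bitLen b :=
  Nat.succ_le_succ (Nat.size_le_size h)

theorem bitLen_le_succ (a : ℕ) : bitLen a ≤ a + 1 :=
  Nat.succ_le_succ (Nat.size_le.2 Nat.lt_two_pow_self)

theorem bitLen_le_iff {a b : ℕ} : bitLen a ≤ b + 1 ↔ a < 2 ^ b := by
  unfold bitLen
  rw [Nat.succ_le_succ_iff, Nat.size_le]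

theorem bitLen_mul_le (a b : ℕ) : bitLen (a * b) ≤ bitLen a + bitLen b := by
  have h : a * b < 2 ^ (Nat.size a + Nat.size b) := by
    rw [pow_add]
    exact Nat.mul_lt_mul'' (Nat.lt_size_self a) (Nat.lt_size_self b)
  have := bitLen_le_iff.2 h
  unfold bitLen at *
  omega

theorem bitLen_add_le (a b : ℕ) : bitLen (a + b) ≤ bitLen a + bitLen b := by
  have h : a + b < 2 ^ (Nat.size a + Nat.size b + 1) := by
    have h₁ := Nat.lt_size_self a
    have h₂ := Nat.lt_size_self b
    have h₃ : 2 ^ Nat.size a ≤ 2 ^ (Nat.size a + Nat.size b) :=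
      Nat.pow_le_pow_right (by norm_num) (by omega)
    have h₄ : 2 ^ Nat.size b ≤ 2 ^ (Nat.size a + Nat.size b) :=
      Nat.pow_le_pow_right (by norm_num) (by omega)
    rw [pow_succ]
    omega
  have := bitLen_le_iff.2 h
  unfold bitLen at *
  omega

theorem bitLen_sum_le {ι : Type*} (s : Finset ι) (f : ι → ℕ) :
    bitLen (∑ i ∈ s, f i) ≤ 1 + ∑ i ∈ s, bitLen (f i) := by
  classical
  induction s using Finset.induction_on with
  | empty => simp [bitLen]
  | insert i s hi ih =>
    rw [Finset.sum_insert hi, Finset.sum_insert hi]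
    have := bitLen_add_le (f i) (∑ i ∈ s, f i)
    omega

/-- All terms lie below one power of two, so summing `L` of them adds only the length of `L`. -/
theorem bitLen_sum_range_le {L B : ℕ} {f : ℕ → ℕ} (h : ∀ u < L, bitLen (f u) ≤ B) :
    bitLen (∑ u ∈ Finset.range L, f u) ≤ bitLen L + B := by
  rcases Nat.eq_zero_or_pos L with rfl | hL
  · simp [bitLen]
  have hB : 1 ≤ B := (bitLen_pos _).trans (h 0 hL)
  obtain ⟨B, rfl⟩ : ∃ B', B = B' + 1 := ⟨B - 1, by omega⟩
  have h₁ : ∑ u ∈ Finset.range L, f u ≤ L * 2 ^ B := by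
    refine (Finset.sum_le_card_nsmul _ _ (2 ^ B) fun u hu => ?_).trans_eq (by simp)
    exact (bitLen_le_iff.1 (h u (Finset.mem_range.1 hu))).le
  refine (bitLen_mono h₁).trans ?_
  have h₂ : L * 2 ^ B < 2 ^ (Nat.size L + B) := by
    rw [pow_add]
    exact Nat.mul_lt_mul_of_pos_right (Nat.lt_size_self L) (by positivity)
  have := bitLen_le_iff.2 h₂
  unfold bitLen at *
  omega

theorem length_le_listLen (x : List ℕ) : x.length ≤ listLen x := by
  unfold listLen
  induction x with
  | nil => simp
  | cons a x ih =>
    have := bitLen_pos a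
    simp only [List.length_cons, List.map_cons, List.sum_cons]
    omega

theorem bitLen_le_listLen {x : List ℕ} {a : ℕ} (h : a ∈ x) : bitLen a ≤ listLen x :=
  List.single_le_sum (by simp) _ (List.mem_map_of_mem h)

/-! ### Terms with bounded sums and their compilation -/

namespace RAM

theorem bitLen_listCells_le (x : List ℕ) (i : ℕ) : bitLen (listCells x i) ≤ listLen x + 1 := by
  unfold listCells
  cases i with
  | zero => simpa using (bitLen_le_succ _).trans (Nat.succ_le_succ (length_le_listLen x))
  | succ i =>
    simp only [List.getD_cons_succ]
    by_cases hi : i < x.length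
    · rw [List.getD_eq_getElem _ _ hi]
      exact (bitLen_le_listLen (List.getElem_mem hi)).trans (Nat.le_succ _)
    · rw [List.getD_eq_default _ _ (not_lt.1 hi)]
      simp [bitLen]

/-- Arithmetic terms in the cells of two input arrays and in variables. `sum v t` sums `t` over the
values of the variable `v` below the total length of the inputs. -/
inductive Term : Type
  | const (n : ℕ) : Term
  | var (v : ℕ) : Term
  | fst (t : Term) : Term
  | snd (t : Term) : Term
  | add (t₁ t₂ : Term) : Term
  | sub (t₁ t₂ : Term) : Term
  | mul (t₁ t₂ : Term) : Term
  | sum (v : ℕ) (t : Term) : Term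

namespace Term

/-- Value of a term. -/
def eval (X Y : ℕ → ℕ) : Term → (ℕ → ℕ) → ℕ
  | const n, _ => n
  | var v, ρ => ρ v
  | fst t, ρ => X (t.eval X Y ρ)
  | snd t, ρ => Y (t.eval X Y ρ)
  | add t₁ t₂, ρ => t₁.eval X Y ρ + t₂.eval X Y ρ
  | sub t₁ t₂, ρ => t₁.eval X Y ρ - t₂.eval X Y ρ
  | mul t₁ t₂, ρ => t₁.eval X Y ρ * t₂.eval X Y ρ
  | sum v t, ρ => ∑ u ∈ Finset.range (X 0 + Y 0), t.eval X Y (Function.update ρ v u)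

/-- The temporary `d`. -/
def tmp (d : ℕ) : Expr := .read 4 (.const d)

/-- A program that stores the value of a term in cell `d` of array `4`, with the values of the
variables in array `3`, and that leaves arrays `0`, `1`, `3` and the cells below `d` of array `4`
unchanged. -/
def compile : Term → ℕ → Prog
  | const n, d => .write 4 (.const d) (.const n)
  | var v, d => .write 4 (.const d) (.read 3 (.const v))
  | fst t, d => .seq (t.compile d) (.write 4 (.const d) (.read 0 (tmp d)))
  | snd t, d => .seq (t.compile d) (.write 4 (.const d) (.read 1 (tmp d)))
  | add t₁ t₂, d => .seq (t₁.compile d) (.seq (t₂.compile (d + 1))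
      (.write 4 (.const d) (.add (tmp d) (tmp (d + 1)))))
  | sub t₁ t₂, d => .seq (t₁.compile d) (.seq (t₂.compile (d + 1))
      (.write 4 (.const d) (.sub (tmp d) (tmp (d + 1)))))
  | mul t₁ t₂, d => .seq (t₁.compile d) (.seq (t₂.compile (d + 1))
      (.write 4 (.const d) (.mul (tmp d) (tmp (d + 1)))))
  -- Cell `d` saves the outer value of the variable, cell `d + 1` is the accumulator, and the
  -- summand works from cell `d + 2` on.
  | sum v t, d =>
      .seq (.write 4 (.const d) (.read 3 (.const v))) <|
      .seq (.write 4 (.const (d + 1)) (.const 0)) <|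
      .seq (.write 3 (.const v) (.const 0)) <|
      .seq (.loop (.sub (.add (.read 0 (.const 0)) (.read 1 (.const 0))) (.read 3 (.const v)))
        (.seq (t.compile (d + 2)) <|
          .seq (.write 4 (.const (d + 1)) (.add (tmp (d + 1)) (tmp (d + 2))))
            (.write 3 (.const v) (.add (.read 3 (.const v)) (.const 1))))) <|
      .seq (.write 3 (.const v) (tmp d)) (.write 4 (.const d) (tmp (d + 1)))

open Polynomial in
/-- Bound for the binary length of the value of a term. -/
noncomputable def valueBound : Term → ℕ[X]
  | const n => C (bitLen n)
  | var _ => X + 1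
  | fst _ => X + 1
  | snd _ => X + 1
  | add t₁ t₂ => t₁.valueBound + t₂.valueBound
  | sub t₁ _ => t₁.valueBound
  | mul t₁ t₂ => t₁.valueBound + t₂.valueBound
  | sum _ t => X + 1 + t.valueBound

open Polynomial in
/-- Bound for the running time of the program of a term. -/
noncomputable def timeBound : Term → ℕ → ℕ[X]
  | const n, d => C (bitLen d + bitLen n + 1)
  | var v, d => C (bitLen d + bitLen v + 1) + (X + 1)
  | fst t, d => t.timeBound d + C (2 * bitLen d + 1) + t.valueBound + (X + 1)
  | snd t, d => t.timeBound d + C (2 * bitLen d + 1) + t.valueBound + (X + 1)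
  | add t₁ t₂, d => t₁.timeBound d + t₂.timeBound (d + 1) + C (2 * bitLen d + bitLen (d + 1) + 1)
      + 2 * (t₁.valueBound + t₂.valueBound)
  | sub t₁ t₂, d => t₁.timeBound d + t₂.timeBound (d + 1) + C (2 * bitLen d + bitLen (d + 1) + 1)
      + 2 * (t₁.valueBound + t₂.valueBound)
  | mul t₁ t₂, d => t₁.timeBound d + t₂.timeBound (d + 1) + C (2 * bitLen d + bitLen (d + 1) + 1)
      + 2 * (t₁.valueBound + t₂.valueBound)
  | sum v t, d =>
      (X + 1) * (t.timeBound (d + 2) + 7 * (X + 2) + 3 * (X + 1 + t.valueBound)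
        + C (3 * bitLen v + 2 * bitLen (d + 1) + bitLen (d + 2) + 20))
      + C (3 * bitLen d + 2 * bitLen (d + 1) + 3 * bitLen v + 20) + 3 * (X + 1)
        + (X + 1 + t.valueBound)

/-- Each operation at most adds the lengths of its operands, and a bounded sum adds the length of
its range. Bounding the variables by the number of input entries keeps the induction going under
`sum`. -/
theorem bitLen_eval_le (x y : List ℕ) (t : Term) : ∀ ρ : ℕ → ℕ,
    (∀ v, ρ v ≤ x.length + y.length) →
    bitLen (t.eval (listCells x) (listCells y) ρ) ≤ t.valueBound.eval (listLen x + listLen y) := by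
  have hx := length_le_listLen x
  have hy := length_le_listLen y
  induction t with
  | const n => intro ρ _; simp [eval, valueBound]
  | var v =>
    intro ρ hρ
    have := bitLen_le_succ (ρ v)
    have := hρ v
    simp only [eval, valueBound, Polynomial.eval_add, Polynomial.eval_X, Polynomial.eval_one]
    omega
  | fst t _ =>
    intro ρ _
    have := bitLen_listCells_le x (t.eval (listCells x) (listCells y) ρ)
    simp only [eval, valueBound, Polynomial.eval_add, Polynomial.eval_X, Polynomial.eval_one]
    omega
  | snd t _ =>
    intro ρ _
    have := bitLen_listCells_le y (t.eval (listCells x) (listCells y) ρ)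
    simp only [eval, valueBound, Polynomial.eval_add, Polynomial.eval_X, Polynomial.eval_one]
    omega
  | add t₁ t₂ ih₁ ih₂ =>
    intro ρ hρ
    simp only [eval, valueBound, Polynomial.eval_add]
    exact (bitLen_add_le _ _).trans (Nat.add_le_add (ih₁ ρ hρ) (ih₂ ρ hρ))
  | sub t₁ t₂ ih₁ ih₂ =>
    intro ρ hρ
    simp only [eval, valueBound]
    exact (bitLen_mono (Nat.sub_le _ _)).trans (ih₁ ρ hρ)
  | mul t₁ t₂ ih₁ ih₂ =>
    intro ρ hρ
    simp only [eval, valueBound, Polynomial.eval_add]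
    exact (bitLen_mul_le _ _).trans (Nat.add_le_add (ih₁ ρ hρ) (ih₂ ρ hρ))
  | sum v t ih =>
    intro ρ hρ
    simp only [eval, valueBound, Polynomial.eval_add, Polynomial.eval_X, Polynomial.eval_one]
    have hL : listCells x 0 + listCells y 0 = x.length + y.length := rfl
    rw [hL]
    refine (bitLen_sum_range_le (B := t.valueBound.eval (listLen x + listLen y))
      fun u hu => ih _ fun w => ?_).trans ?_
    · rcases eq_or_ne w v with rfl | hw
      · rw [Function.update_self]; exact hu.le
      · rw [Function.update_of_ne hw]; exact hρ w
    · have := bitLen_le_succ (x.length + y.length)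
      omega

end Term
end RAM

/-! ### Correctness and running time of compiled terms -/

namespace RAM

theorem Exec.write_four {s : Store} {d : ℕ} {e : Expr} :
    Exec (.write 4 (.const d) e) s (bitLen d + e.cost s + 1)
      (Function.update s 4 (Function.update (s 4) d (e.eval s))) :=
  Exec.write 4 (.const d) e s

namespace Term

/-- Started in `s`, the program `c` halts within time `B`, with the value `a` in cell `d` of array
`4`; arrays `0`, `1`, `3` and the cells below `d` of array `4` are unchanged. -/
def Computes (c : Prog) (d a B : ℕ) (s : Store) : Prop :=
  ∃ (T : ℕ) (s' : Store), Exec c s T s' ∧ T ≤ B ∧ s' 0 = s 0 ∧ s' 1 = s 1 ∧ s' 3 = s 3 ∧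
    (∀ e < d, s' 4 e = s 4 e) ∧ s' 4 d = a

theorem Computes.write (d : ℕ) (e : Expr) (s : Store) :
    Computes (.write 4 (.const d) e) d (e.eval s) (bitLen d + e.cost s + 1) s := by
  refine ⟨_, _, Exec.write_four, le_rfl, by simp, by simp, by simp, fun f hf => ?_, by simp⟩
  simp [hf.ne]

theorem Computes.mono {c : Prog} {d a B B' : ℕ} {s : Store} (h : Computes c d a B s) (hB : B ≤ B') :
    Computes c d a B' s := by
  obtain ⟨T, s', h₁, h₂, h₃⟩ := h
  exact ⟨T, s', h₁, h₂.trans hB, h₃⟩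

theorem Computes.unary {c : Prog} {d a b B B' : ℕ} {s : Store} {e : Expr}
    (h : Computes c d a B s)
    (he : ∀ s' : Store, s' 0 = s 0 → s' 1 = s 1 → s' 4 d = a →
      e.eval s' = b ∧ e.cost s' ≤ B') :
    Computes (.seq c (.write 4 (.const d) e)) d b (B + (bitLen d + B' + 1)) s := by
  obtain ⟨T, s', hc, hT, h0, h1, h3, h4, hd⟩ := h
  obtain ⟨he, hB⟩ := he s' h0 h1 hd
  refine ⟨_, _, hc.seq Exec.write_four, by omega, by simp [h0], by simp [h1], by simp [h3],
    fun f hf => ?_, by simp [he]⟩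
  simp [hf.ne, h4 f hf]

/-- The second program starts in a changed memory, hence the quantifier over `s'`; running at `d +
1`, it preserves the first result in cell `d`. -/
theorem Computes.binary {c₁ c₂ : Prog} {d a₁ a₂ b B₁ B₂ B' : ℕ} {s : Store} {e : Expr}
    (h₁ : Computes c₁ d a₁ B₁ s)
    (h₂ : ∀ s' : Store, s' 0 = s 0 → s' 1 = s 1 → s' 3 = s 3 → Computes c₂ (d + 1) a₂ B₂ s')
    (he : ∀ s' : Store, s' 4 d = a₁ → s' 4 (d + 1) = a₂ → e.eval s' = b ∧ e.cost s' ≤ B') :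
    Computes (.seq c₁ (.seq c₂ (.write 4 (.const d) e))) d b
      (B₁ + (B₂ + (bitLen d + B' + 1))) s := by
  obtain ⟨T, s₁, hc, hT, h0, h1, h3, h4, hd⟩ := h₁
  obtain ⟨T', s', hc', hT', h0', h1', h3', h4', hd'⟩ := h₂ s₁ h0 h1 h3
  obtain ⟨he, hB⟩ := he s' ((h4' d (Nat.lt_succ_self d)).trans hd) hd'
  refine ⟨_, _, hc.seq (hc'.seq Exec.write_four), by omega, by simp [h0, h0'], by simp [h1, h1'],
    by simp [h3, h3'], fun f hf => ?_, by simp [he]⟩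
  simp [hf.ne, h4' f (hf.trans (Nat.lt_succ_self d)), h4 f hf]

theorem update_le {ρ : ℕ → ℕ} {L u : ℕ} (hρ : ∀ v, ρ v ≤ L) (v : ℕ) (hu : u ≤ L) (w : ℕ) :
    Function.update ρ v u w ≤ L := by
  rcases eq_or_ne w v with rfl | hw
  · rwa [Function.update_self]
  · rw [Function.update_of_ne hw]; exact hρ w

/-- The loop that accumulates the values of a term. -/
theorem exec_sum_loop {x y : List ℕ} {t : Term} {v d A B W : ℕ} {ρ : ℕ → ℕ}
    {F : ℕ → ℕ}
    (hF : ∀ u < x.length + y.length, ∀ s : Store, s 0 = listCells x → s 1 = listCells y →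
      s 3 = Function.update ρ v u → Computes (t.compile (d + 2)) (d + 2) (F u) A s)
    (hFb : ∀ u < x.length + y.length, bitLen (F u) ≤ B)
    (hSb : ∀ u ≤ x.length + y.length, bitLen (∑ u ∈ Finset.range u, F u) ≤ B)
    (hW : ∀ u ≤ x.length + y.length, bitLen u ≤ W)
    (hL : bitLen x.length ≤ W ∧ bitLen y.length ≤ W) :
    ∀ r u : ℕ, u + r = x.length + y.length → ∀ s : Store,
      s 0 = listCells x → s 1 = listCells y → s 3 = Function.update ρ v u →
      s 4 (d + 1) = ∑ u ∈ Finset.range u, F u →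
      ∃ (T : ℕ) (s' : Store),
        Exec (.loop (.sub (.add (.read 0 (.const 0)) (.read 1 (.const 0))) (.read 3 (.const v)))
          (.seq (t.compile (d + 2)) <|
          .seq (.write 4 (.const (d + 1)) (.add (tmp (d + 1)) (tmp (d + 2))))
            (.write 3 (.const v) (.add (.read 3 (.const v)) (.const 1))))) s T s' ∧
        T ≤ (r + 1) * (A + 7 * W + 3 * B + (3 * bitLen v + 2 * bitLen (d + 1) + bitLen (d + 2) + 20))
          ∧
        s' 0 = listCells x ∧ s' 1 = listCells y ∧
        s' 3 = Function.update ρ v (x.length + y.length) ∧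
        (∀ e < d + 1, s' 4 e = s 4 e) ∧
        s' 4 (d + 1) = ∑ u ∈ Finset.range (x.length + y.length), F u := by
  have hb0 : bitLen 0 = 1 := by simp [bitLen]
  have hb1 : bitLen 1 = 2 := by simp [bitLen]
  have hx0 : listCells x 0 = x.length := rfl
  have hy0 : listCells y 0 = y.length := rfl
  -- Induction on the number `r` of remaining iterations, with the current value `u` of the variable
  -- general; the invariant is that cell `d + 1` holds the partial sum below `u`.
  intro r
  induction r with
  | zero =>
    intro u hu s h0 h1 h3 h4
    obtain rfl : u = x.length + y.length := by omega
    refine ⟨_, s, Exec.loop_done ?_, ?_, h0, h1, h3, fun _ _ => rfl, h4⟩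
    · simp [Expr.eval, h0, h1, h3, hx0, hy0]
    · have h₁ := hW _ le_rfl
      simp only [Expr.cost, Expr.eval, h0, h1, h3, hx0, hy0, Function.update_self, Nat.sub_self,
        hb0]
      omega
  | succ r ih =>
    intro u hu s h0 h1 h3 h4
    obtain ⟨T, s₁, hc, hT, h0', h1', h3', h4', hd'⟩ := hF u (by omega) s h0 h1 h3
    set s₂ : Store := Function.update s₁ 4 (Function.update (s₁ 4) (d + 1)
      ((Expr.add (tmp (d + 1)) (tmp (d + 2))).eval s₁)) with hs₂
    set s₃ : Store := Function.update s₂ 3 (Function.update (s₂ 3) v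
      ((Expr.add (.read 3 (.const v)) (.const 1)).eval s₂)) with hs₃
    have hsum : s₁ 4 (d + 1) + s₁ 4 (d + 2) = ∑ u ∈ Finset.range (u + 1), F u := by
      rw [Finset.sum_range_succ, hd', h4' (d + 1) (by omega), h4]
    have hv : s₂ 3 v = u := by simp [hs₂, h3', h3]
    have e₁ : Exec (.write 4 (.const (d + 1)) (.add (tmp (d + 1)) (tmp (d + 2)))) s₁ _ s₂ :=
      Exec.write_four
    have e₂ : Exec (.write 3 (.const v) (.add (.read 3 (.const v)) (.const 1))) s₂ _ s₃ :=
      Exec.write _ _ _ _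
    obtain ⟨T', s', hc', hT', h0'', h1'', h3'', h4'', hd''⟩ := ih (u + 1) (by omega) s₃
      (by simp [hs₃, hs₂, h0', h0]) (by simp [hs₃, hs₂, h1', h1])
      (by
        have h : s₃ 3 = Function.update (s₂ 3) v (u + 1) := by simp [hs₃, Expr.eval, hv]
        rw [h]
        simp [hs₂, h3', h3])
      (by simp [hs₃, hs₂, Expr.eval, tmp, hsum])
    refine ⟨_, s', Exec.loop_step ?_ (hc.seq (e₁.seq e₂)) hc', ?_, h0'', h1'', h3'', ?_, hd''⟩
    · simp only [Expr.eval, h0, h1, h3, hx0, hy0, Function.update_self]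
      omega
    · have b₁ := hW u (by omega)
      have b₂ := hW (u + 1) (by omega)
      have b₃ := hW (x.length + y.length - u) (by omega)
      have b₄ := hW _ (le_refl (x.length + y.length))
      have b₅ := hSb (u + 1) (by omega)
      have b₆ := hSb u (by omega)
      have b₇ := hFb u (by omega)
      have b₈ : s₁ 4 (d + 1) = ∑ u ∈ Finset.range u, F u := by rw [h4' (d + 1) (by omega), h4]
      simp only [Expr.cost, Expr.eval, h0, h1, h3, hx0, hy0, Function.update_self, tmp, hsum,
        hb0, hb1, hv]
      rw [Nat.succ_mul (r + 1), b₈, hd']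
      omega
    · intro e he
      rw [h4'' e he]
      simp [hs₃, hs₂, he.ne, h4' e (by omega)]

/-- The induction must be general in `d`, `ρ` and `s`: subterms run at higher cells, under updated
variables, and in memories left behind by other subterms. -/
theorem computes_compile (x y : List ℕ) (t : Term) : ∀ (d : ℕ) (ρ : ℕ → ℕ) (s : Store),
    s 0 = listCells x → s 1 = listCells y → s 3 = ρ → (∀ v, ρ v ≤ x.length + y.length) →
    Computes (t.compile d) d (t.eval (listCells x) (listCells y) ρ)
      ((t.timeBound d).eval (listLen x + listLen y)) s := by
  have hx := length_le_listLen x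
  have hy := length_le_listLen y
  have hb0 : bitLen 0 = 1 := by simp [bitLen]
  have hx0 : listCells x 0 = x.length := rfl
  have hy0 : listCells y 0 = y.length := rfl
  induction t with
  | const n =>
    intro d ρ s h0 h1 h3 hρ
    refine (Computes.write d (.const n) s).mono ?_
    simp [timeBound, Expr.cost]
  | var v =>
    intro d ρ s h0 h1 h3 hρ
    have := Computes.write d (.read 3 (.const v)) s
    simp only [Expr.eval, h3] at this
    refine this.mono ?_
    have h₁ := bitLen_le_succ (ρ v)
    have h₂ := hρ v
    simp only [timeBound, Expr.cost, Expr.eval, h3, Polynomial.eval_add, Polynomial.eval_X,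
      Polynomial.eval_one, Polynomial.eval_C]
    omega
  | fst t ih =>
    intro d ρ s h0 h1 h3 hρ
    refine ((ih d ρ s h0 h1 h3 hρ).unary (b := (fst t).eval (listCells x) (listCells y) ρ)
      (B' := bitLen d + t.valueBound.eval (listLen x + listLen y) + (listLen x + listLen y + 1))
      fun s' g0 g1 g4 => ⟨?_, ?_⟩).mono ?_
    · simp [Expr.eval, tmp, g4, g0, h0, eval]
    · have h₁ := bitLen_listCells_le x (t.eval (listCells x) (listCells y) ρ)
      have h₂ := bitLen_eval_le x y t ρ hρ
      simp only [Expr.cost, Expr.eval, tmp, g4, g0, h0]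
      omega
    · simp only [timeBound, Polynomial.eval_add, Polynomial.eval_X,
        Polynomial.eval_one, Polynomial.eval_C]
      omega
  | snd t ih =>
    intro d ρ s h0 h1 h3 hρ
    refine ((ih d ρ s h0 h1 h3 hρ).unary (b := (snd t).eval (listCells x) (listCells y) ρ)
      (B' := bitLen d + t.valueBound.eval (listLen x + listLen y) + (listLen x + listLen y + 1))
      fun s' g0 g1 g4 => ⟨?_, ?_⟩).mono ?_
    · simp [Expr.eval, tmp, g4, g1, h1, eval]
    · have h₁ := bitLen_listCells_le y (t.eval (listCells x) (listCells y) ρ)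
      have h₂ := bitLen_eval_le x y t ρ hρ
      simp only [Expr.cost, Expr.eval, tmp, g4, g1, h1]
      omega
    · simp only [timeBound, Polynomial.eval_add, Polynomial.eval_X,
        Polynomial.eval_one, Polynomial.eval_C]
      omega
  | add t₁ t₂ ih₁ ih₂ =>
    intro d ρ s h0 h1 h3 hρ
    have b₁ := bitLen_eval_le x y t₁ ρ hρ
    have b₂ := bitLen_eval_le x y t₂ ρ hρ
    have b₃ := bitLen_eval_le x y (add t₁ t₂) ρ hρ
    simp only [eval, valueBound, Polynomial.eval_add] at b₃
    refine ((ih₁ d ρ s h0 h1 h3 hρ).binary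
      (fun s' g0 g1 g3 => ih₂ (d + 1) ρ s' (g0.trans h0) (g1.trans h1) (g3.trans h3) hρ)
      (b := (add t₁ t₂).eval (listCells x) (listCells y) ρ)
      (B' := bitLen d + bitLen (d + 1) + 2 * (t₁.valueBound.eval (listLen x + listLen y) +
        t₂.valueBound.eval (listLen x + listLen y)))
      fun s' g1 g2 => ⟨?_, ?_⟩).mono ?_
    · simp [Expr.eval, tmp, g1, g2, eval]
    · simp only [Expr.cost, Expr.eval, tmp, g1, g2]
      omega
    · simp only [timeBound, Polynomial.eval_add, Polynomial.eval_C, Polynomial.eval_mul,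
        Polynomial.eval_ofNat]
      omega
  | sub t₁ t₂ ih₁ ih₂ =>
    intro d ρ s h0 h1 h3 hρ
    have b₁ := bitLen_eval_le x y t₁ ρ hρ
    have b₂ := bitLen_eval_le x y t₂ ρ hρ
    have b₃ := bitLen_eval_le x y (sub t₁ t₂) ρ hρ
    simp only [eval, valueBound] at b₃
    refine ((ih₁ d ρ s h0 h1 h3 hρ).binary
      (fun s' g0 g1 g3 => ih₂ (d + 1) ρ s' (g0.trans h0) (g1.trans h1) (g3.trans h3) hρ)
      (b := (sub t₁ t₂).eval (listCells x) (listCells y) ρ)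
      (B' := bitLen d + bitLen (d + 1) + 2 * (t₁.valueBound.eval (listLen x + listLen y) +
        t₂.valueBound.eval (listLen x + listLen y)))
      fun s' g1 g2 => ⟨?_, ?_⟩).mono ?_
    · simp [Expr.eval, tmp, g1, g2, eval]
    · simp only [Expr.cost, Expr.eval, tmp, g1, g2]
      omega
    · simp only [timeBound, Polynomial.eval_add, Polynomial.eval_C, Polynomial.eval_mul,
        Polynomial.eval_ofNat]
      omega
  | mul t₁ t₂ ih₁ ih₂ =>
    intro d ρ s h0 h1 h3 hρ
    have b₁ := bitLen_eval_le x y t₁ ρ hρ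
    have b₂ := bitLen_eval_le x y t₂ ρ hρ
    have b₃ := bitLen_eval_le x y (mul t₁ t₂) ρ hρ
    simp only [eval, valueBound, Polynomial.eval_add] at b₃
    refine ((ih₁ d ρ s h0 h1 h3 hρ).binary
      (fun s' g0 g1 g3 => ih₂ (d + 1) ρ s' (g0.trans h0) (g1.trans h1) (g3.trans h3) hρ)
      (b := (mul t₁ t₂).eval (listCells x) (listCells y) ρ)
      (B' := bitLen d + bitLen (d + 1) + 2 * (t₁.valueBound.eval (listLen x + listLen y) +
        t₂.valueBound.eval (listLen x + listLen y)))
      fun s' g1 g2 => ⟨?_, ?_⟩).mono ?_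
    · simp [Expr.eval, tmp, g1, g2, eval]
    · simp only [Expr.cost, Expr.eval, tmp, g1, g2]
      omega
    · simp only [timeBound, Polynomial.eval_add, Polynomial.eval_C, Polynomial.eval_mul,
        Polynomial.eval_ofNat]
      omega
  | sum v t ih =>
    intro d ρ s h0 h1 h3 hρ
    set N := listLen x + listLen y with hN
    set L := x.length + y.length with hL
    have hW : ∀ u ≤ L, bitLen u ≤ N + 1 := fun u hu => by
      have := bitLen_le_succ u
      omega
    have hF : ∀ u ≤ L, bitLen (t.eval (listCells x) (listCells y) (Function.update ρ v u)) ≤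
        t.valueBound.eval N := fun u hu => bitLen_eval_le x y t _ (update_le hρ v hu)
    have hS : ∀ u ≤ L, bitLen (∑ u ∈ Finset.range u,
        t.eval (listCells x) (listCells y) (Function.update ρ v u)) ≤
        N + 1 + t.valueBound.eval N := fun u hu => by
      have h₁ := bitLen_sum_range_le (L := u) fun u' hu' => hF u' (by omega)
      have h₂ := hW u hu
      omega
    set s₁ : Store := Function.update s 4 (Function.update (s 4) d (ρ v)) with hs₁
    set s₂ : Store := Function.update s₁ 4 (Function.update (s₁ 4) (d + 1) 0) with hs₂
    set s₃ : Store := Function.update s₂ 3 (Function.update (s₂ 3) v 0) with hs₃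
    have e₁ : Exec (.write 4 (.const d) (.read 3 (.const v))) s
        (bitLen d + (bitLen v + bitLen (ρ v)) + 1) s₁ := by
      have := Exec.write 4 (.const d) (.read 3 (.const v)) s
      simpa only [Expr.cost, Expr.eval, h3] using this
    have e₂ : Exec (.write 4 (.const (d + 1)) (.const 0)) s₁ (bitLen (d + 1) + bitLen 0 + 1) s₂ :=
      Exec.write _ _ _ _
    have e₃ : Exec (.write 3 (.const v) (.const 0)) s₂ (bitLen v + bitLen 0 + 1) s₃ :=
      Exec.write _ _ _ _
    obtain ⟨T, s₄, e₄, hT, g0, g1, g3, g4, gd⟩ := exec_sum_loop (t := t) (v := v) (d := d) (ρ := ρ)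
      (A := (t.timeBound (d + 2)).eval N) (B := N + 1 + t.valueBound.eval N) (W := N + 1)
      (F := fun u => t.eval (listCells x) (listCells y) (Function.update ρ v u))
      (fun u hu s h0 h1 h3 => ih (d + 2) _ s h0 h1 h3 (update_le hρ v hu.le))
      (fun u hu => (hF u hu.le).trans (Nat.le_add_left _ _)) hS hW
      ⟨hW _ (Nat.le_add_right _ _), hW _ (Nat.le_add_left _ _)⟩ L 0 (by omega) s₃
      (by simp [hs₃, hs₂, hs₁, h0]) (by simp [hs₃, hs₂, hs₁, h1]) (by simp [hs₃, hs₂, hs₁, h3])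
      (by simp [hs₃, hs₂])
    -- The loop leaves the cells below `d + 1` alone, so the saved value is still available to
    -- restore the variable.
    have hd : s₄ 4 d = ρ v := by
      rw [g4 d (Nat.lt_succ_self d)]
      simp [hs₃, hs₂, hs₁]
    set s₅ : Store := Function.update s₄ 3 (Function.update (s₄ 3) v (ρ v)) with hs₅
    have e₅ : Exec (.write 3 (.const v) (tmp d)) s₄
        (bitLen v + (bitLen d + bitLen (ρ v)) + 1) s₅ := by
      have := Exec.write 3 (.const v) (tmp d) s₄
      simpa only [Expr.cost, Expr.eval, tmp, hd] using this
    set S := ∑ u ∈ Finset.range L, t.eval (listCells x) (listCells y) (Function.update ρ v u)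
      with hSdef
    have hd' : s₅ 4 (d + 1) = S := by simpa [hs₅] using gd
    set s₆ : Store := Function.update s₅ 4 (Function.update (s₅ 4) d S) with hs₆
    have e₆ : Exec (.write 4 (.const d) (tmp (d + 1))) s₅
        (bitLen d + (bitLen (d + 1) + bitLen S) + 1) s₆ := by
      have := Exec.write 4 (.const d) (tmp (d + 1)) s₅
      simpa only [Expr.cost, Expr.eval, tmp, hd'] using this
    refine ⟨_, s₆, e₁.seq (e₂.seq (e₃.seq (e₄.seq (e₅.seq e₆)))), ?_, ?_, ?_, ?_, ?_, ?_⟩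
    · have b₁ := hW _ (hρ v)
      have b₂ : bitLen S ≤ N + 1 + t.valueBound.eval N := hS L le_rfl
      have hLN : L ≤ N := by omega
      have b₃ : T ≤ (N + 1) * ((t.timeBound (d + 2)).eval N + 7 * (N + 2) +
          3 * (N + 1 + t.valueBound.eval N) +
          (3 * bitLen v + 2 * bitLen (d + 1) + bitLen (d + 2) + 20)) := by
        refine hT.trans (Nat.mul_le_mul (by omega) ?_)
        omega
      simp only [timeBound, Polynomial.eval_add, Polynomial.eval_C, Polynomial.eval_mul,
        Polynomial.eval_ofNat, Polynomial.eval_X, Polynomial.eval_one, hb0]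
      omega
    · simp [hs₆, hs₅, g0, h0]
    · simp [hs₆, hs₅, g1, h1]
    · simp [hs₆, hs₅, g3, h3]
    · intro e he
      simp [hs₆, hs₅, he.ne, g4 e (by omega), hs₃, hs₂, hs₁, (he.trans (Nat.lt_succ_self d)).ne]
    · simp [hs₆, eval, hx0, hy0, hSdef, hL]

/-- The program that answers `1` if the value of a term is nonzero and `0` otherwise. -/
def decider (t : Term) : Prog :=
  .seq (t.compile 0) (.write 2 (.const 0) (.sub (.const 1) (.sub (.const 1) (tmp 0))))

theorem exec_decider (t : Term) (x y : List ℕ) : ∃ (T : ℕ) (s : Store),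
    Exec t.decider (initStore x y) T s ∧
      T ≤ (t.timeBound 0 + t.valueBound + Polynomial.C 12).eval (listLen x + listLen y) ∧
      s 2 0 = 1 - (1 - t.eval (listCells x) (listCells y) fun _ => 0) := by
  obtain ⟨T, s, e, hT, -, -, -, -, hd⟩ := computes_compile x y t 0 (fun _ => 0) (initStore x y)
    rfl rfl rfl (fun _ => Nat.zero_le _)
  have hb := bitLen_eval_le x y t (fun _ => 0) (fun _ => Nat.zero_le _)
  refine ⟨_, _, e.seq (Exec.write _ _ _ _), ?_, ?_⟩
  · have hb0 : bitLen 0 = 1 := by simp [bitLen]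
    have hb1 : bitLen 1 = 2 := by simp [bitLen]
    have h : ∀ a, bitLen (1 - a) ≤ 2 := fun a => hb1 ▸ bitLen_mono (Nat.sub_le 1 a)
    have h₁ := h (t.eval (listCells x) (listCells y) fun _ => 0)
    have h₂ := h (1 - t.eval (listCells x) (listCells y) fun _ => 0)
    simp only [Expr.cost, Expr.eval, tmp, hd, Polynomial.eval_add, Polynomial.eval_C, hb0, hb1]
    omega
  · simp [Expr.eval, tmp, hd]

theorem accepts_decider {t : Term} {x y : List ℕ} :
    Accepts t.decider x y ↔ t.eval (listCells x) (listCells y) (fun _ => 0) ≠ 0 := by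
  obtain ⟨T, s, e, -, h⟩ := exec_decider t x y
  constructor
  · rintro ⟨T', s', e', h'⟩ h0
    -- Acceptance only asserts some halting run; determinism identifies it with the run constructed
    -- above.
    obtain ⟨-, rfl⟩ := e.det e'
    rw [h0] at h
    omega
  · intro h0
    exact ⟨T, s, e, by omega⟩

theorem runsInTime_decider (t : Term) :
    RunsInTime t.decider (t.timeBound 0 + t.valueBound + Polynomial.C 12) := fun x y => by
  obtain ⟨T, s, e, hT, -⟩ := exec_decider t x y
  exact ⟨T, s, e, hT⟩

end Term
end RAM

/-- A problem is in NP if it has short certificates that are checked by a term. -/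
theorem InNP.of_term {L : Set (List ℕ)} (t : RAM.Term) (q : Polynomial ℕ)
    (sound : ∀ x y, t.eval (RAM.listCells x) (RAM.listCells y) (fun _ => 0) ≠ 0 → x ∈ L)
    (complete : ∀ x ∈ L, ∃ y, listLen y ≤ q.eval (listLen x) ∧
      t.eval (RAM.listCells x) (RAM.listCells y) (fun _ => 0) ≠ 0) : InNP L := by
  refine ⟨t.decider, _, q, t.runsInTime_decider, fun x => ⟨fun hx => ?_, ?_⟩⟩
  · obtain ⟨y, hy, h⟩ := complete x hx
    exact ⟨y, hy, RAM.Term.accepts_decider.2 h⟩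
  · rintro ⟨y, -, h⟩
    exact sound x y (RAM.Term.accepts_decider.1 h)

/-! ### Integer combinations with few vectors -/

section ShortDecomposition

variable {ι : Type} [Fintype ι]

theorem vecLen_mono {v w : ι → ℕ} (h : v ≤ w) : vecLen v ≤ vecLen w :=
  Finset.sum_le_sum fun i _ => bitLen_mono (h i)

theorem bitLen_le_vecLen (v : ι → ℕ) (i : ι) : bitLen (v i) ≤ vecLen v :=
  Finset.single_le_sum (f := fun i => bitLen (v i)) (fun _ _ => Nat.zero_le _) (Finset.mem_univ i)

/-- If a combination with positive coefficients has too many vectors, then two disjoint sets of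
them have the same sum. -/
theorem exists_disjoint_sum_eq {T : Finset (ι → ℕ)} {b : ι → ℕ} (hb : ∑ x ∈ T, x ≤ b)
    (hT : vecLen b < T.card) :
    ∃ A ⊆ T, ∃ B ⊆ T, Disjoint A B ∧ A.Nonempty ∧ ∑ x ∈ A, x = ∑ x ∈ B, x := by
  classical
  -- Pigeonhole: `2 ^ T.card` subsets against `∏ (b i + 1) ≤ 2 ^ vecLen b` possible subset sums.
  have hcard : (Fintype.piFinset fun i => Finset.range (b i + 1)).card < T.powerset.card := by
    rw [Fintype.card_piFinset, Finset.card_powerset]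
    simp only [Finset.card_range]
    calc ∏ i, (b i + 1) ≤ ∏ i, 2 ^ bitLen (b i) := Finset.prod_le_prod' fun i _ =>
          (Nat.lt_size_self (b i)).trans (Nat.pow_lt_pow_right (by norm_num) (Nat.lt_succ_self _))
      _ = 2 ^ vecLen b := Finset.prod_pow_eq_pow_sum _ _ _
      _ < 2 ^ T.card := Nat.pow_lt_pow_right (by norm_num) hT
  have hmaps : ∀ A ∈ T.powerset, ∑ x ∈ A, x ∈ Fintype.piFinset fun i => Finset.range (b i + 1) := by
    intro A hA
    rw [Fintype.mem_piFinset]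
    intro i
    rw [Finset.mem_range, Nat.lt_succ_iff]
    exact ((Finset.sum_le_sum_of_subset (Finset.mem_powerset.1 hA)).trans hb) i
  obtain ⟨A, hA, B, hB, hne, hsum⟩ := Finset.exists_ne_map_eq_of_card_lt_of_maps_to hcard hmaps
  rw [Finset.mem_powerset] at hA hB
  -- Two distinct sets cannot each contain the other. Discarding the common elements then makes them
  -- disjoint without destroying the equality of sums.
  wlog hAB : (A \ B).Nonempty generalizing A B
  · refine this B hB A hA hne.symm hsum.symm ?_
    rw [Finset.not_nonempty_iff_eq_empty, Finset.sdiff_eq_empty_iff_subset] at hAB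
    rw [Finset.sdiff_nonempty]
    exact fun h => hne (hAB.antisymm h)
  refine ⟨A \ B, Finset.sdiff_subset.trans hA, B \ A, Finset.sdiff_subset.trans hB,
    disjoint_sdiff_sdiff, hAB, ?_⟩
  have h₁ := Finset.sum_sdiff (f := id) (Finset.inter_subset_left (s₁ := A) (s₂ := B))
  have h₂ := Finset.sum_sdiff (f := id) (Finset.inter_subset_right (s₁ := A) (s₂ := B))
  rw [Finset.sdiff_inter_self_left] at h₁
  rw [Finset.inter_comm, Finset.sdiff_inter_self_left, Finset.inter_comm] at h₂
  simp only [id] at h₁ h₂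
  exact add_right_cancel (h₁.trans (hsum.trans h₂.symm))

theorem exists_small_combination (b : ι → ℕ) (T : Finset (ι → ℕ)) : ∀ l : (ι → ℕ) → ℕ,
    (∀ x ∈ T, l x ≠ 0) → ∑ x ∈ T, l x • x = b →
    ∃ T' ⊆ T, ∃ l' : (ι → ℕ) → ℕ, (∀ x ∈ T', l' x ≠ 0) ∧ ∑ x ∈ T', l' x • x = b ∧
      T'.card ≤ vecLen b := by
  classical
  induction T using Finset.strongInduction with
  | H T ih =>
    intro l hl hsum
    by_cases hT : T.card ≤ vecLen b
    · exact ⟨T, subset_rfl, l, hl, hsum, hT⟩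
    have hle : ∑ x ∈ T, x ≤ b := by
      rw [← hsum]
      refine Finset.sum_le_sum fun x hx i => ?_
      exact Nat.le_mul_of_pos_left _ (Nat.pos_of_ne_zero (hl x hx))
    obtain ⟨A, hA, B, hB, hAB, hne, heq⟩ := exists_disjoint_sum_eq hle (not_le.1 hT)
    obtain ⟨z, hz, hmin⟩ := Finset.exists_min_image A l hne
    -- Move the least multiplicity on `A`, attained at `z`, from all of `A` to all of `B`. The
    -- combination keeps its value because both sets have the same sum, nothing becomes negative,
    -- and `z` drops out.
    let l' : (ι → ℕ) → ℕ := fun x =>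
      if x ∈ A then l x - l z else if x ∈ B then l x + l z else l x
    have hl' : ∑ x ∈ T, l' x • x = b := by
      have h : ∑ x ∈ T, (l' x • x + if x ∈ A then l z • x else 0) =
          ∑ x ∈ T, (l x • x + if x ∈ B then l z • x else 0) := by
        refine Finset.sum_congr rfl fun x _ => ?_
        by_cases hxA : x ∈ A
        · have hxB : x ∉ B := Finset.disjoint_left.1 hAB hxA
          simp only [l', hxA, hxB, if_true, if_false, add_zero]
          rw [← add_smul, Nat.sub_add_cancel (hmin x hxA)]
        · by_cases hxB : x ∈ B <;> simp [l', hxA, hxB, add_smul]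
      rw [Finset.sum_add_distrib, Finset.sum_add_distrib, hsum, ← Finset.sum_filter,
        ← Finset.sum_filter, Finset.filter_mem_eq_inter, Finset.filter_mem_eq_inter,
        Finset.inter_eq_right.2 hA, Finset.inter_eq_right.2 hB, ← Finset.smul_sum,
        ← Finset.smul_sum, heq] at h
      exact add_right_cancel h
    have hss : T.filter (fun x => l' x ≠ 0) ⊂ T := by
      rw [Finset.filter_ssubset]
      exact ⟨z, hA hz, by simp [l', hz]⟩
    obtain ⟨T', hT', m, h⟩ := ih _ hss l' (fun x hx => (Finset.mem_filter.1 hx).2) (by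
      rw [← hl', Finset.sum_filter]
      refine Finset.sum_congr rfl fun x _ => ?_
      by_cases hx : l' x = 0 <;> simp [hx])
    exact ⟨T', hT'.trans hss.subset, m, h⟩

/-- If `b` is an integer combination of vectors that each have a positive entry, then it is one with
few of them, of total length at most `2 ⟨b⟩²`. -/
theorem HasShortDecomposition.of_sum {X : Set (ι → ℕ)} {b : ι → ℕ} {M : Type*} [Fintype M]
    (g : M → ι → ℕ) (hg : ∀ μ, g μ ∈ X) (hsum : ∑ μ, g μ = b) (hX : ∀ x ∈ X, ∃ i, x i ≠ 0)
    {B : ℕ} (hB : 2 * vecLen b ^ 2 ≤ B) :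
    HasShortDecomposition X b B := by
  classical
  obtain ⟨T, hT, l, hl, hlb, hcard⟩ := exists_small_combination b (Finset.univ.image g)
    (fun x => (Finset.univ.filter fun μ => g μ = x).card)
    (fun x hx => by
      obtain ⟨μ, -, rfl⟩ := Finset.mem_image.1 hx
      exact Finset.card_ne_zero.2 ⟨μ, by simp⟩)
    (by
      rw [← hsum]
      simpa using (Finset.sum_comp (fun x : ι → ℕ => x) g).symm)
  have hmem : ∀ x ∈ T, x ∈ X := fun x hx => by
    obtain ⟨μ, -, rfl⟩ := Finset.mem_image.1 (hT hx)
    exact hg μ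
  let mult : (ι → ℕ) →₀ ℕ := Finsupp.onFinset T (fun x => if x ∈ T then l x else 0)
    fun x hx => by by_contra h; simp [h] at hx
  have hsupp : mult.support = T := by
    ext x
    by_cases hx : x ∈ T <;> simp [mult, hx, hl x]
  have hval : ∀ x ∈ T, mult x = l x := fun x hx => by simp [mult, hx]
  refine ⟨mult, fun x hx => hmem x (hsupp ▸ hx), ?_, hsupp ▸ hcard, ?_⟩
  · rw [Finsupp.sum, hsupp, ← hlb]
    exact Finset.sum_congr rfl fun x hx => by rw [hval x hx]
  · rw [Finsupp.sum, hsupp]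
    refine le_trans ?_ hB
    calc _ ≤ T.card • (2 * vecLen b) := Finset.sum_le_card_nsmul _ _ _ fun x hx => ?_
      _ ≤ vecLen b * (2 * vecLen b) := Nat.mul_le_mul_right _ hcard
      _ = 2 * vecLen b ^ 2 := by ring
    have hx₀ : l x • x ≤ b := by
      rw [← hlb]
      exact Finset.single_le_sum (f := fun x => l x • x) (fun _ _ => zero_le) hx
    have hx₁ : x ≤ b := le_trans (fun i => Nat.le_mul_of_pos_left _ (Nat.pos_of_ne_zero (hl x hx)))
      hx₀
    -- A positive entry of `x` bounds its multiplicity by an entry of `b`; the multiplicity of a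
    -- zero vector would be unbounded.
    obtain ⟨i, hi⟩ := hX x (hmem x hx)
    have hx₂ : l x ≤ b i := (Nat.le_mul_of_pos_right _ (Nat.pos_of_ne_zero hi)).trans (hx₀ i)
    have h₁ := vecLen_mono hx₁
    have h₂ := (bitLen_mono hx₂).trans (bitLen_le_vecLen b i)
    rw [hval x hx]
    omega

end ShortDecomposition

/-! ### Jobs on a single machine -/

section SingleMachine

variable {α : Type*}

/-- Remove a job that starts last: if it has positive length, the other jobs must end by its start,
which serves as the new deadline. -/
theorem sum_le_of_no_overlap [DecidableEq α] {start : α → ℝ} {p : α → ℕ}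
    (hstart : ∀ a, 0 ≤ start a) (A : Finset α) : ∀ T : ℝ, 0 ≤ T →
    (∀ a ∈ A, ∀ b ∈ A, a ≠ b → start a + p a ≤ start b ∨ start b + p b ≤ start a) →
    (∀ a ∈ A, start a + p a ≤ T) → ∑ a ∈ A, (p a : ℝ) ≤ T := by
  induction A using Finset.strongInduction with
  | H A ih =>
    intro T hT hA hAT
    rcases A.eq_empty_or_nonempty with rfl | hne
    · simpa using hT
    obtain ⟨e, he, hmax⟩ := Finset.exists_max_image A start hne
    rw [← Finset.sum_erase_add _ _ he]
    have hsub : ∀ a ∈ A.erase e, ∀ b ∈ A.erase e, a ≠ b →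
        start a + p a ≤ start b ∨ start b + p b ≤ start a := fun a ha b hb =>
      hA a (Finset.mem_of_mem_erase ha) b (Finset.mem_of_mem_erase hb)
    -- A last-starting job of length zero may share its start with a longer job, so it does not give
    -- a deadline; it is dropped at no cost.
    rcases Nat.eq_zero_or_pos (p e) with hp | hp
    · simpa [hp] using ih _ (Finset.erase_ssubset he) T hT hsub fun a ha =>
        hAT a (Finset.mem_of_mem_erase ha)
    · have hp' : (0 : ℝ) < p e := by exact_mod_cast hp
      have h := ih _ (Finset.erase_ssubset he) (start e) (hstart e) hsub fun a ha => by
        obtain ⟨hae, ha⟩ := Finset.mem_erase.1 ha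
        have h₁ := hmax a ha
        rcases hA a ha e he hae with h₂ | h₂
        · exact h₂
        · linarith
      linarith [hAT e he]

/-- The start of `a` is at least the total length of the jobs finished by then, recorded by `d a b`.
Of two distinct jobs one precedes the other, so together they pay at least the minimum; the ordered
double sum sees this twice, and its diagonal absorbs one copy of `∑ w a * p a`. -/
theorem sum_sum_min_le_of_no_overlap {start : α → ℝ} {p w : α → ℕ}
    (hstart : ∀ a, 0 ≤ start a) (A : Finset α)
    (hA : ∀ a ∈ A, ∀ b ∈ A, a ≠ b → start a + p a ≤ start b ∨ start b + p b ≤ start a) :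
    ((∑ a ∈ A, w a * p a + ∑ a ∈ A, ∑ b ∈ A, min (w a * p b) (w b * p a) : ℕ) : ℝ) ≤
      2 * ∑ a ∈ A, (w a : ℝ) * (start a + p a) := by
  classical
  let d : α → α → ℝ := fun a b => if a ≠ b ∧ start b + p b ≤ start a then (p b : ℝ) else 0
  have hd : ∀ a ∈ A, ∑ b ∈ A, d a b ≤ start a := fun a ha => by
    rw [← Finset.sum_filter]
    refine sum_le_of_no_overlap hstart _ _ (hstart a) (fun b hb c hc => ?_) fun b hb => ?_
    · exact hA b (Finset.mem_filter.1 hb).1 c (Finset.mem_filter.1 hc).1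
    · exact (Finset.mem_filter.1 hb).2.2
  have h₁ : ∀ a ∈ A, (w a : ℝ) * (∑ b ∈ A, d a b + p a) ≤ w a * (start a + p a) := fun a ha =>
    mul_le_mul_of_nonneg_left (by linarith [hd a ha]) (Nat.cast_nonneg _)
  have h₂ : ∀ a ∈ A, ∀ b ∈ A, ((min (w a * p b) (w b * p a) : ℕ) : ℝ) ≤
      (w a * d a b + w b * d b a) + if a = b then (w a : ℝ) * p a else 0 := fun a ha b hb => by
    push_cast
    by_cases hab : a = b
    · subst hab
      simp [d]
    · have hba : b ≠ a := Ne.symm hab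
      have h0 : ∀ a b, 0 ≤ (w a : ℝ) * d a b := fun a b => by
        refine mul_nonneg (Nat.cast_nonneg _) ?_
        dsimp only [d]
        split_ifs <;> positivity
      rcases hA a ha b hb hab with h | h
      · have h' : d b a = p a := by simp [d, hba, h]
        rw [if_neg hab, h']
        linarith [min_le_right ((w a : ℝ) * p b) (w b * p a), h0 a b]
      · have h' : d a b = p b := by simp [d, hab, h]
        rw [if_neg hab, h']
        linarith [min_le_left ((w a : ℝ) * p b) (w b * p a), h0 b a]
  have h₃ : ((∑ a ∈ A, ∑ b ∈ A, min (w a * p b) (w b * p a) : ℕ) : ℝ) ≤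
      2 * ∑ a ∈ A, ∑ b ∈ A, (w a : ℝ) * d a b + ∑ a ∈ A, (w a : ℝ) * p a := by
    push_cast [-Nat.cast_min]
    refine (Finset.sum_le_sum fun a ha => Finset.sum_le_sum fun b hb => h₂ a ha b hb).trans_eq ?_
    simp only [Finset.sum_add_distrib]
    rw [Finset.sum_comm (f := fun a b => (w b : ℝ) * d b a), two_mul]
    congr 1
    exact Finset.sum_congr rfl fun a ha => by rw [Finset.sum_ite_eq]; simp [ha]
  have h₄ := Finset.sum_le_sum h₁
  simp only [mul_add, Finset.sum_add_distrib, Finset.mul_sum] at h₄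
  rw [Nat.cast_add]
  push_cast [mul_add, Finset.sum_add_distrib] at h₃ h₄ ⊢
  linarith

/-- The equality case of `sum_sum_min_le_of_no_overlap`: in Smith order, the cost caused by each
pair is precisely the minimum. -/
theorem two_mul_sum_eq_of_sorted {K : Type*} [LinearOrder K] {key : α → K} {p w : α → ℕ}
    (A : Finset α) (hkey : ∀ a ∈ A, ∀ b ∈ A, key a = key b → a = b)
    (hA : ∀ a ∈ A, ∀ b ∈ A, key a < key b → w b * p a ≤ w a * p b) :
    2 * ∑ a ∈ A, w a * (∑ b ∈ A.filter (fun b => key b < key a), p b + p a) =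
      ∑ a ∈ A, w a * p a + ∑ a ∈ A, ∑ b ∈ A, min (w a * p b) (w b * p a) := by
  classical
  have h : ∀ a ∈ A, ∀ b ∈ A, min (w a * p b) (w b * p a) =
      ((if key b < key a then w a * p b else 0) + if key a < key b then w b * p a else 0) +
        if a = b then w a * p a else 0 := fun a ha b hb => by
    rcases lt_trichotomy (key a) (key b) with h | h | h
    · have hab : a ≠ b := fun e => h.ne (congrArg key e)
      simp [h, h.not_gt, hab, hA a ha b hb h]
    · obtain rfl := hkey a ha b hb h
      simp
    · have hab : a ≠ b := fun e => h.ne' (congrArg key e)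
      simp [h, h.not_gt, hab, hA b hb a ha h]
  rw [Finset.sum_congr rfl fun a ha => Finset.sum_congr rfl (h a ha)]
  simp only [Finset.sum_add_distrib]
  rw [Finset.sum_comm (f := fun a b => if key a < key b then w b * p a else 0)]
  have h' : ∑ a ∈ A, ∑ b ∈ A, (if a = b then w a * p a else 0) = ∑ a ∈ A, w a * p a :=
    Finset.sum_congr rfl fun a ha => by rw [Finset.sum_ite_eq]; simp [ha]
  rw [h']
  have hf : ∀ a, w a * ∑ b ∈ A.filter (fun b => key b < key a), p b =
      ∑ b ∈ A, if key b < key a then w a * p b else 0 := fun a => by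
    rw [Finset.sum_filter, Finset.mul_sum]
    simp only [mul_ite, mul_zero]
  simp only [mul_add, Finset.sum_add_distrib, hf]
  ring

end SingleMachine

namespace HMInstance

variable (I : HMInstance)

/-! ### The value of a configuration -/

/-- Clearing denominators lets later arguments ignore the convention for infinite ratios: if `b` has
processing time zero, the left side vanishes. -/
theorem cross_mul_le_of_smithRatio_le {i : Fin I.κ} {a b : Fin I.τ}
    (h : I.smithRatio i a ≤ I.smithRatio i b) : I.w a * I.p i b ≤ I.w b * I.p i a := by
  unfold smithRatio at h
  by_cases hb : I.p i b = 0
  · simp [hb]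
  by_cases ha : I.p i a = 0
  · simp [ha, hb] at h
  rw [if_neg ha, if_neg hb, WithTop.coe_le_coe, div_le_div_iff₀ (by positivity) (by positivity)] at h
  exact_mod_cast h

/-- Twice the value of a configuration, without reference to an order of the jobs. -/
def twiceCost (i : Fin I.κ) (c : Fin I.τ → ℕ) : ℕ :=
  ∑ j, c j * (I.w j * I.p i j) +
    ∑ j, c j * ∑ j', c j' * min (I.w j * I.p i j') (I.w j' * I.p i j)

/-- Putting `j` in front delays the whole tail by the processing time of `j`. As `j` has the largest
ratio, this delay costs exactly the minima in the row of `j`, and equally those in its column. -/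
theorem two_mul_seqCost {i : Fin I.κ} (l : List (Fin I.τ))
    (hl : l.Pairwise fun a b => I.smithRatio i b ≤ I.smithRatio i a) : ∀ t : ℕ,
    2 * I.seqCost i t l = 2 * (t * (l.map I.w).sum) + ((l.map fun a => I.w a * I.p i a).sum +
      (l.map fun a => (l.map fun b => min (I.w a * I.p i b) (I.w b * I.p i a)).sum).sum) := by
  induction l with
  | nil => intro t; simp [seqCost]
  | cons j l ih =>
    intro t
    obtain ⟨hj, hl⟩ := List.pairwise_cons.1 hl
    have h₁ : (l.map fun b => min (I.w j * I.p i b) (I.w b * I.p i j)).sum =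
        (l.map I.w).sum * I.p i j := by
      rw [← List.sum_map_mul_right]
      congr 1
      exact List.map_congr_left fun b hb => min_eq_right (I.cross_mul_le_of_smithRatio_le (hj b hb))
    have h₂ : (l.map fun a => min (I.w a * I.p i j) (I.w j * I.p i a)).sum =
        (l.map I.w).sum * I.p i j := by
      rw [← h₁]
      simp only [min_comm]
    rw [seqCost, mul_add, ih hl]
    simp only [List.map_cons, List.sum_cons, List.sum_map_add, min_self, h₁, h₂]
    ring

theorem sum_map_configJobs (c : Fin I.τ → ℕ) (g : Fin I.τ → ℕ) :
    ((I.configJobs c).map g).sum = ∑ j, c j * g j := by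
  simp [configJobs, List.map_flatten, List.sum_flatten, List.map_ofFn, List.sum_ofFn,
    Function.comp_def]

theorem two_mul_smithCost (i : Fin I.κ) (c : Fin I.τ → ℕ) :
    2 * I.smithCost i c = I.twiceCost i c := by
  have htrans : IsTrans (Fin I.τ) fun a b => I.smithRatio i b ≤ I.smithRatio i a :=
    ⟨fun _ _ _ h₁ h₂ => h₂.trans h₁⟩
  have htotal : Std.Total fun a b => I.smithRatio i b ≤ I.smithRatio i a :=
    ⟨fun a b => le_total _ _⟩
  have hp := List.perm_insertionSort (fun a b => I.smithRatio i b ≤ I.smithRatio i a)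
    (I.configJobs c)
  rw [smithCost, I.two_mul_seqCost _ (List.pairwise_insertionSort _ _), twiceCost]
  have h : ∀ g : Fin I.τ → ℕ, (((I.configJobs c).insertionSort
      fun a b => I.smithRatio i b ≤ I.smithRatio i a).map g).sum = ∑ j, c j * g j := fun g => by
    rw [(hp.map g).sum_eq, sum_map_configJobs]
  simp only [h, zero_mul, mul_zero, zero_add]

/-! ### Schedules and configurations of machines -/

/-- The configuration of a machine under an assignment of jobs to machines. -/
def conf {I : HMInstance} (f : I.Job → I.Machine) (μ : I.Machine) (j : Fin I.τ) : ℕ :=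
  (Finset.univ.filter fun u : Fin (I.n j) => f ⟨j, u⟩ = μ).card

variable {I}

theorem sum_jobs_eq (f : I.Job → I.Machine) (μ : I.Machine) (g : Fin I.τ → ℕ) :
    ∑ a ∈ Finset.univ.filter (fun a => f a = μ), g a.1 = ∑ j, conf f μ j * g j := by
  rw [Finset.sum_filter, Fintype.sum_sigma]
  refine Finset.sum_congr rfl fun j _ => ?_
  rw [← Finset.sum_filter]
  change ∑ _u ∈ Finset.univ.filter (fun u => f ⟨j, u⟩ = μ), g j = _
  rw [Finset.sum_const, smul_eq_mul, conf]

theorem sum_conf (f : I.Job → I.Machine) : ∑ μ, conf f μ = I.n := by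
  ext j
  rw [Finset.sum_apply]
  simpa [conf] using (Finset.card_eq_sum_card_fiberwise (f := fun u : Fin (I.n j) => f ⟨j, u⟩)
    (s := Finset.univ) (t := Finset.univ) (fun _ _ => Finset.mem_univ _)).symm

/-- For each type, the number of jobs is the sum of the entries of all configurations, so any
bijection onto the slots of the machines distributes them. -/
theorem exists_assignment {c : I.Machine → Fin I.τ → ℕ} (hc : ∑ μ, c μ = I.n) :
    ∃ f : I.Job → I.Machine, conf f = c := by
  have h : ∀ j, Nonempty (Fin (I.n j) ≃ (μ : I.Machine) × Fin (c μ j)) := fun j => by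
    rw [← Fintype.card_eq]
    simp [← hc]
  refine ⟨fun a => ((Classical.choice (h a.1)) a.2).1, ?_⟩
  ext μ j
  rw [conf, Finset.card_equiv (Classical.choice (h j)) (t := Finset.univ.filter fun q => q.1 = μ)
    (by simp)]
  rw [Finset.card_filter, Fintype.sum_sigma]
  simp [apply_ite Finset.card]

/-- The processing time of a job under an assignment of jobs to machines. -/
def procTime (f : I.Job → I.Machine) (a : I.Job) : ℕ := I.p (f a).1 a.1

theorem sum_procTime (f : I.Job → I.Machine) (μ : I.Machine) :
    ∑ a ∈ Finset.univ.filter (fun a => f a = μ), procTime f a = ∑ j, I.p μ.1 j * conf f μ j := by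
  have := sum_jobs_eq f μ (I.p μ.1)
  simp only [mul_comm] at this ⊢
  rw [← this]
  refine Finset.sum_congr rfl fun a ha => ?_
  rw [procTime, (Finset.mem_filter.1 ha).2]

theorem sum_twiceCost (f : I.Job → I.Machine) (μ : I.Machine) :
    ∑ a ∈ Finset.univ.filter (fun a => f a = μ), I.w a.1 * procTime f a +
      ∑ a ∈ Finset.univ.filter (fun a => f a = μ), ∑ b ∈ Finset.univ.filter (fun a => f a = μ),
        min (I.w a.1 * procTime f b) (I.w b.1 * procTime f a) = I.twiceCost μ.1 (conf f μ) := by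
  have h : ∀ a ∈ Finset.univ.filter (fun a => f a = μ), procTime f a = I.p μ.1 a.1 :=
    fun a ha => by rw [procTime, (Finset.mem_filter.1 ha).2]
  rw [twiceCost, ← sum_jobs_eq f μ, ← sum_jobs_eq f μ]
  congr 1
  · exact Finset.sum_congr rfl fun a ha => by rw [h a ha]
  · refine Finset.sum_congr rfl fun a ha => ?_
    rw [← sum_jobs_eq f μ (fun j => min (I.w a.1 * I.p μ.1 j) (I.w j * I.p μ.1 a.1))]
    exact Finset.sum_congr rfl fun b hb => by rw [h a ha, h b hb]

/-- Sorting key: Smith ratio, ties broken arbitrarily. -/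
noncomputable def key (f : I.Job → I.Machine) (a : I.Job) :
    (WithTop ℚ)ᵒᵈ ×ₗ Fin (Fintype.card I.Job) :=
  toLex (OrderDual.toDual (I.smithRatio (f a).1 a.1), Fintype.equivFin I.Job a)

theorem key_injective (f : I.Job → I.Machine) : Function.Injective (key f) := fun a b h => by
  have := congrArg (fun x => (ofLex x).2) h
  exact (Fintype.equivFin I.Job).injective this

theorem cross_mul_le_of_key_lt {f : I.Job → I.Machine} {a b : I.Job} (hf : f a = f b)
    (h : key f a < key f b) : I.w b.1 * procTime f a ≤ I.w a.1 * procTime f b := by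
  have h₁ : I.smithRatio (f a).1 b.1 ≤ I.smithRatio (f a).1 a.1 := by
    have := Prod.Lex.monotone_fst _ _ h.le
    rw [hf]
    simpa [key, hf] using this
  have := I.cross_mul_le_of_smithRatio_le h₁
  rwa [procTime, procTime, ← hf]

/-- The jobs that precede a job on its machine, in the order of non-increasing Smith ratio. -/
noncomputable def preds (f : I.Job → I.Machine) (a : I.Job) : Finset I.Job :=
  (Finset.univ.filter fun b => f b = f a).filter fun b => key f b < key f a

/-- The schedule without idle time by non-increasing Smith ratio on each machine. -/
noncomputable def smithSchedule (f : I.Job → I.Machine) : I.Schedule where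
  machine := f
  start a := (∑ b ∈ preds f a, procTime f b : ℕ)
  start_nonneg _ := Nat.cast_nonneg _
  no_overlap a b hab hf := by
    have h : ∀ a b : I.Job, f a = f b → key f a < key f b →
        ∑ x ∈ preds f a, procTime f x + procTime f a ≤ ∑ x ∈ preds f b, procTime f x := by
      intro a b hf h
      -- The job `a` and its predecessors form a set of predecessors of `b`, so `b` starts only
      -- after `a` is completed.
      have ha : a ∉ preds f a := by simp [preds]
      rw [add_comm, ← Finset.sum_insert ha]
      refine Finset.sum_le_sum_of_subset fun x hx => ?_
      rcases Finset.mem_insert.1 hx with rfl | hx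
      · simp [preds, hf, h]
      · simp only [preds, Finset.mem_filter, Finset.mem_univ, true_and] at hx ⊢
        exact ⟨hx.1.trans hf, hx.2.trans h⟩
    rcases lt_trichotomy (key f a) (key f b) with h' | h' | h'
    · left
      exact_mod_cast h a b hf h'
    · exact absurd (key_injective f h') hab
    · right
      exact_mod_cast h b a hf.symm h'

theorem completion_smithSchedule (f : I.Job → I.Machine) (a : I.Job) :
    (smithSchedule f).completion a = (∑ b ∈ preds f a, procTime f b + procTime f a : ℕ) := by
  rw [Nat.cast_add]
  rfl

/-- Without idle time, the load of a machine is its last completion time in any order; the Smith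
schedule is used only because it is at hand. -/
theorem cmaxYes_iff (k : ℕ) : I.CmaxYes k ↔ ∃ c : I.Machine → Fin I.τ → ℕ,
    ∑ μ, c μ = I.n ∧ ∀ μ, ∑ j, I.p μ.1 j * c μ j ≤ k := by
  constructor
  · rintro ⟨S, hS⟩
    refine ⟨conf S.machine, sum_conf _, fun μ => ?_⟩
    rw [← sum_procTime]
    have := sum_le_of_no_overlap (p := procTime S.machine) S.start_nonneg
      (Finset.univ.filter fun a => S.machine a = μ) k (Nat.cast_nonneg _)
      (fun a ha b hb hab => S.no_overlap a b hab
        ((Finset.mem_filter.1 ha).2.trans (Finset.mem_filter.1 hb).2.symm)) fun a _ => hS a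
    exact_mod_cast this
  · rintro ⟨c, hc, hk⟩
    obtain ⟨f, rfl⟩ := exists_assignment hc
    refine ⟨smithSchedule f, fun a => ?_⟩
    rw [completion_smithSchedule, Nat.cast_le]
    refine le_trans ?_ (hk (f a))
    have ha : a ∉ preds f a := by simp [preds]
    rw [← sum_procTime, add_comm, ← Finset.sum_insert ha]
    refine Finset.sum_le_sum_of_subset fun x hx => ?_
    rcases Finset.mem_insert.1 hx with rfl | hx
    · simp
    · simp only [preds, Finset.mem_filter, Finset.mem_univ, true_and] at hx ⊢
      exact hx.1

/-- On each machine the pairwise minima bound every schedule from below, and the Smith schedule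
attains them. Both sides are compared after doubling. -/
theorem sumWCYes_iff (k : ℕ) : I.SumWCYes k ↔ ∃ c : I.Machine → Fin I.τ → ℕ,
    ∑ μ, c μ = I.n ∧ ∑ μ, I.smithCost μ.1 (c μ) ≤ k := by
  constructor
  · rintro ⟨S, hS⟩
    refine ⟨conf S.machine, sum_conf _, ?_⟩
    have h : ∀ μ : I.Machine, ((I.smithCost μ.1 (conf S.machine μ) : ℕ) : ℝ) ≤
        ∑ a ∈ Finset.univ.filter (fun a => S.machine a = μ), (I.w a.1 : ℝ) * S.completion a := by
      intro μ
      have := sum_sum_min_le_of_no_overlap (p := procTime S.machine) (w := fun a => I.w a.1)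
        S.start_nonneg (Finset.univ.filter fun a => S.machine a = μ)
        (fun a ha b hb hab => S.no_overlap a b hab
          ((Finset.mem_filter.1 ha).2.trans (Finset.mem_filter.1 hb).2.symm))
      rw [sum_twiceCost, ← two_mul_smithCost, Nat.cast_mul, Nat.cast_ofNat] at this
      exact le_of_mul_le_mul_left this two_pos
    have := (Finset.sum_le_sum fun μ (_ : μ ∈ Finset.univ) => h μ).trans
      ((Finset.sum_fiberwise _ _ _).trans_le hS)
    exact_mod_cast this
  · rintro ⟨c, hc, hk⟩
    obtain ⟨f, rfl⟩ := exists_assignment hc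
    refine ⟨smithSchedule f, ?_⟩
    have h : ∑ a, I.w a.1 * (∑ b ∈ preds f a, procTime f b + procTime f a) =
        ∑ μ, I.smithCost μ.1 (conf f μ) := by
      rw [← Finset.sum_fiberwise _ f]
      refine Finset.sum_congr rfl fun μ _ => ?_
      apply Nat.eq_of_mul_eq_mul_left two_pos
      rw [two_mul_smithCost, ← sum_twiceCost, ← two_mul_sum_eq_of_sorted (key := key f)
        (p := procTime f) (w := fun a => I.w a.1) _ (fun _ _ _ _ h => key_injective f h)
        (fun a ha b hb h => cross_mul_le_of_key_lt
          ((Finset.mem_filter.1 ha).2.trans (Finset.mem_filter.1 hb).2.symm) h)]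
      congr 1
      refine Finset.sum_congr rfl fun a ha => ?_
      rw [preds, (Finset.mem_filter.1 ha).2]
    simp only [completion_smithSchedule]
    rw [← h] at hk
    exact_mod_cast hk

/-- Replace row `s` by `l s` copies. The copies of kind `i` are as many as the machines of kind `i`,
so bijections on these fibres combine into one between machines and copies. -/
theorem exists_row_assignment {S : Type*} [Fintype S] {kind l : S → ℕ}
    (hk : ∀ s, l s ≠ 0 → kind s < I.κ)
    (hm : ∀ i : Fin I.κ, ∑ s, (if kind s = i then l s else 0) = I.m i) :
    ∃ g : I.Machine → S, (∀ μ, l (g μ) ≠ 0 ∧ kind (g μ) = μ.1) ∧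
      ∀ F : S → ℕ, ∑ μ, F (g μ) = ∑ s, l s * F s := by
  have hl : ∀ q : (s : S) × Fin (l s), l q.1 ≠ 0 := fun q => (Fin.pos q.2).ne'
  let kind' : ((s : S) × Fin (l s)) → Fin I.κ := fun q => ⟨kind q.1, hk q.1 (hl q)⟩
  have h : ∀ i, Nonempty ({μ : I.Machine // μ.1 = i} ≃ {q // kind' q = i}) := fun i => by
    rw [← Fintype.card_eq, Fintype.card_subtype, Fintype.card_subtype, Finset.card_filter,
      Finset.card_filter, Fintype.sum_sigma, Fintype.sum_sigma]
    simp only [kind', Fin.ext_iff, Finset.sum_const, Finset.card_univ, Fintype.card_fin,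
      smul_eq_mul, mul_ite, mul_one, mul_zero, hm]
    simp [← Fin.ext_iff]
  let e := Equiv.ofFiberEquiv fun i => Classical.choice (h i)
  refine ⟨fun μ => (e μ).1, fun μ => ⟨hl _, ?_⟩, fun F => ?_⟩
  · exact congrArg Fin.val (Equiv.ofFiberEquiv_map (fun i => Classical.choice (h i)) μ)
  · rw [e.sum_comp fun q => F q.1, Fintype.sum_sigma]
    simp

end HMInstance

/-! ### Decompositions as sequences of rows -/

theorem HasShortDecomposition.mono {ι : Type} [Fintype ι] {X : Set (ι → ℕ)} {b : ι → ℕ} {B B' : ℕ}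
    (h : HasShortDecomposition X b B) (hB : B ≤ B') : HasShortDecomposition X b B' := by
  obtain ⟨mult, h₁, h₂, h₃, h₄⟩ := h
  exact ⟨mult, h₁, h₂, h₃, h₄.trans hB⟩

/-- The vectors and the multiplicities of a short decomposition, as sequences. -/
theorem HasShortDecomposition.exists_seq {ι : Type} [Fintype ι] {X : Set (ι → ℕ)} {b : ι → ℕ}
    {B : ℕ} (h : HasShortDecomposition X b B) :
    ∃ (r : ℕ) (x : ℕ → ι → ℕ) (l : ℕ → ℕ), r ≤ vecLen b ∧ (∀ s < r, x s ∈ X) ∧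
      (∀ i, ∑ s ∈ Finset.range r, l s * x s i = b i) ∧
      ∀ s < r, vecLen (x s) ≤ B ∧ bitLen (l s) ≤ B := by
  obtain ⟨mult, hX, hsum, hcard, hB⟩ := h
  let e := mult.support.equivFin
  let x : ℕ → ι → ℕ := fun s => if h : s < mult.support.card then (e.symm ⟨s, h⟩ : ι → ℕ) else 0
  have hx : ∀ s : Fin mult.support.card, x s = e.symm s := fun s => by simp [x]
  have hmem : ∀ s < mult.support.card, x s ∈ mult.support := fun s hs => by
    rw [hx ⟨s, hs⟩]
    exact (e.symm ⟨s, hs⟩).2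
  refine ⟨mult.support.card, x, fun s => mult (x s), hcard, fun s hs => hX _ (hmem s hs),
    fun i => ?_, fun s hs => ?_⟩
  · rw [Finset.sum_range fun s => mult (x s) * x s i, ← hsum, Finsupp.sum, Finset.sum_apply,
      ← Finset.sum_coe_sort mult.support fun c => (mult c • c) i, ← e.symm.sum_comp]
    simp [hx]
  · have h₁ : vecLen (x s) + bitLen (mult (x s)) ≤ B :=
      (Finset.single_le_sum (f := fun x => vecLen x + bitLen (mult x)) (fun _ _ => Nat.zero_le _)
        (hmem s hs)).trans hB
    exact ⟨(Nat.le_add_right _ _).trans h₁, (Nat.le_add_left _ _).trans h₁⟩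

namespace HMInstance

variable {I : HMInstance}

/-! ### Yes-instances and decompositions -/

/-- Rows that consist of a machine kind, a multiplicity and a configuration, and that cover all
machines and all jobs. -/
def Covers (I : HMInstance) (r : ℕ) (kind l : ℕ → ℕ) (c : ℕ → Fin I.τ → ℕ) : Prop :=
  (∀ s < r, l s ≠ 0 → kind s < I.κ) ∧
  (∀ i : Fin I.κ, ∑ s ∈ Finset.range r, (if kind s = i then l s else 0) = I.m i) ∧
  ∀ j, ∑ s ∈ Finset.range r, l s * c s j = I.n j

theorem Covers.exists_assignment {r : ℕ} {kind l : ℕ → ℕ} {c : ℕ → Fin I.τ → ℕ}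
    (h : I.Covers r kind l c) : ∃ g : I.Machine → Fin r,
      (∀ μ, l (g μ) ≠ 0 ∧ kind (g μ) = μ.1) ∧ (∑ μ, c (g μ) = I.n) ∧
      ∀ F : ℕ → ℕ, ∑ μ, F (g μ) = ∑ s ∈ Finset.range r, l s * F s := by
  obtain ⟨h₁, h₂, h₃⟩ := h
  obtain ⟨g, hg, hF⟩ := exists_row_assignment (I := I) (S := Fin r) (kind := fun s => kind s)
    (l := fun s => l s) (fun s => h₁ s s.2) (fun i => by
      rw [← h₂ i, Finset.sum_range fun s => if kind s = i then l s else 0])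
  refine ⟨g, hg, ?_, fun F => ?_⟩
  · ext j
    rw [Finset.sum_apply, hF fun s => c s j, ← h₃ j, Finset.sum_range fun s => l s * c s j]
  · rw [hF fun s => F s, Finset.sum_range fun s => l s * F s]

theorem Covers.cmaxYes {r k : ℕ} {kind l : ℕ → ℕ} {c : ℕ → Fin I.τ → ℕ}
    (h : I.Covers r kind l c)
    (hk : ∀ s < r, l s ≠ 0 → ∀ i : Fin I.κ, kind s = i → ∑ j, I.p i j * c s j ≤ k) :
    I.CmaxYes k := by
  obtain ⟨g, hg, hn, -⟩ := h.exists_assignment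
  exact (cmaxYes_iff k).2 ⟨fun μ => c (g μ), hn, fun μ =>
    hk _ (g μ).2 (hg μ).1 μ.1 (hg μ).2⟩

theorem Covers.sumWCYes {r k : ℕ} {kind l : ℕ → ℕ} {c : ℕ → Fin I.τ → ℕ}
    (h : I.Covers r kind l c) (F : ℕ → ℕ)
    (hF : ∀ s < r, l s ≠ 0 → ∀ i : Fin I.κ, kind s = i → I.twiceCost i (c s) ≤ F s)
    (hk : ∑ s ∈ Finset.range r, l s * F s ≤ 2 * k) : I.SumWCYes k := by
  obtain ⟨g, hg, hn, hsum⟩ := h.exists_assignment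
  refine (sumWCYes_iff k).2 ⟨fun μ => c (g μ), hn, ?_⟩
  refine Nat.le_of_mul_le_mul_left (le_trans ?_ hk) two_pos
  rw [← hsum, Finset.mul_sum]
  refine Finset.sum_le_sum fun μ _ => ?_
  rw [two_mul_smithCost]
  exact hF _ (g μ).2 (hg μ).1 μ.1 (hg μ).2

theorem sum_single_machine (i : Fin I.κ) :
    ∑ μ : I.Machine, (Pi.single μ.1 1 : Fin I.κ → ℕ) i = I.m i := by
  rw [Fintype.sum_sigma]
  simp [Pi.single_apply]

theorem CmaxYes.hasShortDecomposition {k : ℕ} (h : I.CmaxYes k) :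
    HasShortDecomposition (I.extConfCmax k) I.targetCmax (2 * vecLen I.targetCmax ^ 2) := by
  obtain ⟨c, hn, hk⟩ := (cmaxYes_iff k).1 h
  refine HasShortDecomposition.of_sum (X := I.extConfCmax k)
    (fun μ => Sum.elim (c μ) (Pi.single μ.1 1))
    (fun μ => ⟨μ.1, c μ, hk μ, rfl⟩) ?_ ?_ le_rfl
  · ext (j | i)
    · simp [targetCmax, ← hn]
    · rw [Finset.sum_apply]
      exact sum_single_machine i
  · rintro _ ⟨i, c, -, rfl⟩
    -- The unit vector supplies the positive entry that bounds multiplicities, even for an empty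
    -- configuration.
    exact ⟨Sum.inr i, by simp⟩

theorem hasShortDecomposition_sumWC {k : ℕ} {c : I.Machine → Fin I.τ → ℕ}
    (hn : ∑ μ, c μ = I.n) {F : I.Machine → ℕ} (hF : ∀ μ, I.smithCost μ.1 (c μ) ≤ F μ)
    (hk : ∑ μ, F μ = k) :
    HasShortDecomposition (I.extConfSumWC k) (I.targetSumWC k)
      (2 * vecLen (I.targetSumWC k) ^ 2) := by
  refine HasShortDecomposition.of_sum (X := I.extConfSumWC k)
    (fun μ => Sum.elim (c μ) (Sum.elim (fun _ => F μ) (Pi.single μ.1 1)))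
    (fun μ => ⟨μ.1, c μ, F μ, ?_, hF μ, ?_, rfl⟩) ?_ ?_ le_rfl
  · rw [← hn]
    exact Finset.single_le_sum (f := c) (fun _ _ => zero_le) (Finset.mem_univ μ)
  · rw [← hk]
    exact Finset.single_le_sum (f := F) (fun _ _ => zero_le) (Finset.mem_univ μ)
  · ext (j | u | i)
    · simp [targetSumWC, ← hn]
    · simp [targetSumWC, ← hk]
    · rw [Finset.sum_apply]
      exact sum_single_machine i
  · rintro _ ⟨i, c, F, -, -, -, rfl⟩
    exact ⟨Sum.inr (Sum.inr i), by simp⟩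

/-- Reading the unit vector of each extended configuration as a machine kind turns the machine
coordinates of the decomposition into counts of rows by kind. -/
theorem exists_covers_of_cmax {k B : ℕ}
    (h : HasShortDecomposition (I.extConfCmax k) I.targetCmax B) :
    ∃ (r : ℕ) (kind l : ℕ → ℕ) (c : ℕ → Fin I.τ → ℕ), r ≤ vecLen I.targetCmax ∧
      I.Covers r kind l c ∧
      (∀ s < r, ∀ i : Fin I.κ, kind s = i → ∑ j, I.p i j * c s j ≤ k) ∧
      ∀ s < r, kind s < I.κ ∧ bitLen (l s) ≤ B ∧ ∀ j, bitLen (c s j) ≤ B := by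
  obtain ⟨r, x, l, hr, hX, hsum, hB⟩ := h.exists_seq
  have h : ∀ s, ∃ a : ℕ, s < r → ∃ i : Fin I.κ, (i : ℕ) = a ∧
      (∑ j, I.p i j * x s (Sum.inl j) ≤ k) ∧
      ∀ i', x s (Sum.inr i') = if a = i' then 1 else 0 := fun s => by
    by_cases hs : s < r
    · obtain ⟨i, c, hk, hx⟩ := hX s hs
      refine ⟨i, fun _ => ⟨i, rfl, by simpa [hx] using hk, fun i' => ?_⟩⟩
      simp [hx, Pi.single_apply, Fin.ext_iff, eq_comm]
    · exact ⟨0, fun h => absurd h hs⟩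
  choose kind hkind using h
  refine ⟨r, kind, l, fun s j => x s (Sum.inl j), hr, ⟨fun s hs _ => ?_, fun i => ?_, fun j =>
    hsum (Sum.inl j)⟩, fun s hs i hi => ?_, fun s hs => ⟨?_, (hB s hs).2, fun j =>
      (bitLen_le_vecLen (x s) _).trans (hB s hs).1⟩⟩
  · obtain ⟨i, hi, -⟩ := hkind s hs
    exact hi ▸ i.2
  · rw [← show I.targetCmax (Sum.inr i) = I.m i from rfl, ← hsum]
    refine Finset.sum_congr rfl fun s hs => ?_
    obtain ⟨-, -, -, hx⟩ := hkind s (Finset.mem_range.1 hs)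
    simp [hx]
  · obtain ⟨i', hi', hk, -⟩ := hkind s hs
    obtain rfl : i' = i := Fin.ext (hi'.trans hi)
    exact hk
  · obtain ⟨i, hi, -⟩ := hkind s hs
    exact hi ▸ i.2

/-- The cost coordinate is doubled so that it can be compared with `twiceCost` without division. -/
theorem exists_covers_of_sumWC {k B : ℕ}
    (h : HasShortDecomposition (I.extConfSumWC k) (I.targetSumWC k) B) :
    ∃ (r : ℕ) (kind l : ℕ → ℕ) (c : ℕ → Fin I.τ → ℕ) (F : ℕ → ℕ), r ≤ vecLen (I.targetSumWC k) ∧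
      I.Covers r kind l c ∧
      (∀ s < r, ∀ i : Fin I.κ, kind s = i → I.twiceCost i (c s) ≤ F s) ∧
      (∑ s ∈ Finset.range r, l s * F s ≤ 2 * k) ∧
      ∀ s < r, kind s < I.κ ∧ bitLen (l s) ≤ B ∧ ∀ j, bitLen (c s j) ≤ B := by
  obtain ⟨r, x, l, hr, hX, hsum, hB⟩ := h.exists_seq
  have h : ∀ s, ∃ a : ℕ, s < r → ∃ i : Fin I.κ, (i : ℕ) = a ∧
      (I.smithCost i (fun j => x s (Sum.inl j)) ≤ x s (Sum.inr (Sum.inl ()))) ∧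
      ∀ i', x s (Sum.inr (Sum.inr i')) = if a = i' then 1 else 0 := fun s => by
    by_cases hs : s < r
    · obtain ⟨i, c, F, -, hF, -, hx⟩ := hX s hs
      refine ⟨i, fun _ => ⟨i, rfl, by simpa [hx] using hF, fun i' => ?_⟩⟩
      simp [hx, Pi.single_apply, Fin.ext_iff, eq_comm]
    · exact ⟨0, fun h => absurd h hs⟩
  choose kind hkind using h
  refine ⟨r, kind, l, fun s j => x s (Sum.inl j), fun s => 2 * x s (Sum.inr (Sum.inl ())), hr,
    ⟨fun s hs _ => ?_, fun i => ?_, fun j => hsum (Sum.inl j)⟩, fun s hs i hi => ?_, ?_,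
    fun s hs => ⟨?_, (hB s hs).2, fun j => (bitLen_le_vecLen (x s) _).trans (hB s hs).1⟩⟩
  · obtain ⟨i, hi, -⟩ := hkind s hs
    exact hi ▸ i.2
  · rw [← show I.targetSumWC k (Sum.inr (Sum.inr i)) = I.m i from rfl, ← hsum]
    refine Finset.sum_congr rfl fun s hs => ?_
    obtain ⟨-, -, -, hx⟩ := hkind s (Finset.mem_range.1 hs)
    simp [hx]
  · obtain ⟨i', hi', hk, -⟩ := hkind s hs
    obtain rfl : i' = i := Fin.ext (hi'.trans hi)
    rw [← two_mul_smithCost]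
    exact Nat.mul_le_mul_left 2 hk
  · refine le_of_eq ?_
    rw [← show I.targetSumWC k (Sum.inr (Sum.inl ())) = k from rfl, ← hsum, Finset.mul_sum]
    exact Finset.sum_congr rfl fun s _ => Nat.mul_left_comm _ _ _
  · obtain ⟨i, hi, -⟩ := hkind s hs
    exact hi ▸ i.2

/-- Soundness needs no length bound: `B` is arbitrary. -/
theorem cmaxYes_of_hasShortDecomposition {k B : ℕ}
    (h : HasShortDecomposition (I.extConfCmax k) I.targetCmax B) : I.CmaxYes k := by
  obtain ⟨r, kind, l, c, -, hc, hk, -⟩ := exists_covers_of_cmax h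
  exact hc.cmaxYes fun s hs _ => hk s hs

theorem sumWCYes_of_hasShortDecomposition {k B : ℕ}
    (h : HasShortDecomposition (I.extConfSumWC k) (I.targetSumWC k) B) : I.SumWCYes k := by
  obtain ⟨r, kind, l, c, F, -, hc, hF, hk, -⟩ := exists_covers_of_sumWC h
  exact hc.sumWCYes F (fun s hs _ => hF s hs) hk

theorem SumWCYes.mono {k k' : ℕ} (h : I.SumWCYes k') (hk : k' ≤ k) : I.SumWCYes k := by
  obtain ⟨S, hS⟩ := h
  exact ⟨S, hS.trans (by exact_mod_cast hk)⟩

/-- If there is a machine, the slack can be assigned to it. -/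
theorem SumWCYes.hasShortDecomposition {k : ℕ} (h : I.SumWCYes k) (hm : ∃ i, 0 < I.m i) :
    HasShortDecomposition (I.extConfSumWC k) (I.targetSumWC k)
      (2 * vecLen (I.targetSumWC k) ^ 2) := by
  obtain ⟨c, hn, hk⟩ := (sumWCYes_iff k).1 h
  obtain ⟨i, hi⟩ := hm
  let μ₀ : I.Machine := ⟨i, 0, hi⟩
  refine hasShortDecomposition_sumWC (F := fun μ => I.smithCost μ.1 (c μ) +
    (Pi.single μ₀ (k - ∑ μ, I.smithCost μ.1 (c μ)) : I.Machine → ℕ) μ) hn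
    (fun μ => Nat.le_add_right _ _) ?_
  rw [Finset.sum_add_distrib, Finset.sum_pi_single']
  simp [hk]

/-! ### Lengths -/

theorem vecLen_sumElim {ι κ : Type} [Fintype ι] [Fintype κ] (v : ι → ℕ) (w : κ → ℕ) :
    vecLen (Sum.elim v w) = vecLen v + vecLen w := by
  simp [vecLen]

theorem vecLen_targetCmax_le : vecLen I.targetCmax ≤ I.len := by
  rw [targetCmax, vecLen_sumElim, len]
  omega

theorem vecLen_targetSumWC_le (k : ℕ) : vecLen (I.targetSumWC k) ≤ I.len + bitLen k := by
  rw [targetSumWC, vecLen_sumElim, vecLen_sumElim, len]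
  have : vecLen (fun _ : Unit => k) = bitLen k := by simp [vecLen]
  omega

theorem card_le_vecLen {n : ℕ} (v : Fin n → ℕ) : n ≤ vecLen v := by
  have := Finset.card_nsmul_le_sum Finset.univ (fun i => bitLen (v i)) 1 fun i _ => bitLen_pos _
  simpa [vecLen] using this

/-- No job completes later than the total processing time. In terms of `twiceCost`, the diagonal
part and the double sum are each at most the product on the right. -/
theorem smithCost_le (i : Fin I.κ) (c : Fin I.τ → ℕ) :
    I.smithCost i c ≤ (∑ j, c j * I.w j) * ∑ j, c j * I.p i j := by
  refine le_of_mul_le_mul_left (?_ : 2 * _ ≤ 2 * _) two_pos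
  rw [two_mul_smithCost, twiceCost, two_mul, Finset.sum_mul]
  refine Nat.add_le_add (Finset.sum_le_sum fun j _ => ?_) (Finset.sum_le_sum fun j _ => ?_)
  · have h : c j * I.p i j ≤ ∑ j, c j * I.p i j :=
      Finset.single_le_sum (f := fun j => c j * I.p i j) (fun _ _ => Nat.zero_le _)
        (Finset.mem_univ j)
    rcases Nat.eq_zero_or_pos (c j) with hc | hc
    · simp [hc]
    · rw [← mul_assoc]
      exact Nat.mul_le_mul_left _ ((Nat.le_mul_of_pos_left _ hc).trans h)
  · rw [mul_assoc]
    refine Nat.mul_le_mul_left _ ?_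
    rw [Finset.mul_sum]
    refine Finset.sum_le_sum fun j' _ => ?_
    calc c j' * min (I.w j * I.p i j') (I.w j' * I.p i j) ≤ c j' * (I.w j * I.p i j') :=
          Nat.mul_le_mul_left _ (min_le_left _ _)
      _ = I.w j * (c j' * I.p i j') := by ring

theorem sum_smithCost_le {c : I.Machine → Fin I.τ → ℕ} (hn : ∑ μ, c μ = I.n) :
    ∑ μ, I.smithCost μ.1 (c μ) ≤ (∑ j, I.n j * I.w j) * ∑ i, ∑ j, I.n j * I.p i j := by
  have hc : ∀ μ j, c μ j ≤ I.n j := fun μ j => by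
    rw [← hn]
    exact Finset.single_le_sum (f := c) (fun _ _ => zero_le) (Finset.mem_univ μ) j
  calc ∑ μ, I.smithCost μ.1 (c μ)
      ≤ ∑ μ : I.Machine, (∑ j, c μ j * I.w j) * ∑ i, ∑ j, I.n j * I.p i j :=
        Finset.sum_le_sum fun μ _ => (smithCost_le _ _).trans <| Nat.mul_le_mul_left _ <|
          (Finset.sum_le_sum fun j _ => Nat.mul_le_mul_right _ (hc μ j)).trans <|
            Finset.single_le_sum (f := fun i => ∑ j, I.n j * I.p i j) (fun _ _ => Nat.zero_le _)
              (Finset.mem_univ μ.1)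
    _ = (∑ j, I.n j * I.w j) * ∑ i, ∑ j, I.n j * I.p i j := by
        rw [← Finset.sum_mul, Finset.sum_comm]
        congr 1
        refine Finset.sum_congr rfl fun j _ => ?_
        rw [← Finset.sum_mul, ← hn, Finset.sum_apply]

theorem bitLen_sum_mul_le {ι : Type} [Fintype ι] (v w : ι → ℕ) :
    bitLen (∑ j, v j * w j) ≤ 1 + (vecLen v + vecLen w) := by
  refine (bitLen_sum_le _ _).trans (Nat.add_le_add_left ?_ 1)
  rw [vecLen, vecLen, ← Finset.sum_add_distrib]
  exact Finset.sum_le_sum fun j _ => bitLen_mul_le _ _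

/-- The cost of a distribution of all jobs has length polynomial in the instance, whatever bound `k`
was given; this permits a certificate bound independent of `k`. -/
theorem bitLen_sum_smithCost_le {c : I.Machine → Fin I.τ → ℕ} (hn : ∑ μ, c μ = I.n) :
    bitLen (∑ μ, I.smithCost μ.1 (c μ)) ≤ I.len ^ 2 + 4 * I.len + 2 := by
  refine (bitLen_mono (sum_smithCost_le hn)).trans ((bitLen_mul_le _ _).trans ?_)
  have h₁ := bitLen_sum_mul_le I.n I.w
  have h₂ : bitLen (∑ i, ∑ j, I.n j * I.p i j) ≤ 1 + ∑ i, (1 + (vecLen I.n + vecLen (I.p i))) :=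
    (bitLen_sum_le _ _).trans
      (Nat.add_le_add_left (Finset.sum_le_sum fun i _ => bitLen_sum_mul_le I.n (I.p i)) 1)
  simp only [Finset.sum_add_distrib, Finset.sum_const, Finset.card_univ, Fintype.card_fin,
    smul_eq_mul, mul_one] at h₂
  have h₃ := card_le_vecLen I.m
  -- The job numbers recur once per machine kind; `κ` is at most the length of `m` because every
  -- entry, even zero, has positive length.
  have h₄ : I.κ * vecLen I.n ≤ I.len ^ 2 := by
    rw [sq]
    exact Nat.mul_le_mul (h₃.trans (by rw [len]; omega)) (by rw [len]; omega)
  have h₅ : vecLen I.n + vecLen I.m + (∑ i, vecLen (I.p i)) + vecLen I.w = I.len := rfl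
  omega

/-- The polynomial that bounds the lengths of decompositions. -/
noncomputable def decompositionBound : Polynomial ℕ :=
  2 * (Polynomial.X ^ 2 + 5 * Polynomial.X + 2) ^ 2

theorem eval_decompositionBound (N : ℕ) :
    decompositionBound.eval N = 2 * (N ^ 2 + 5 * N + 2) ^ 2 := by
  simp [decompositionBound]

/-! ### Equivalence of yes-instances and short decompositions -/

theorem cmaxYes_iff_hasShortDecomposition (k : ℕ) : I.CmaxYes k ↔
    HasShortDecomposition (I.extConfCmax k) I.targetCmax (decompositionBound.eval I.len) := by
  refine ⟨fun h => h.hasShortDecomposition.mono ?_, cmaxYes_of_hasShortDecomposition⟩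
  rw [eval_decompositionBound]
  have := vecLen_targetCmax_le (I := I)
  gcongr
  nlinarith

theorem sumWCYes_iff_hasShortDecomposition (k : ℕ) (hm : ∃ i, 0 < I.m i) : I.SumWCYes k ↔
    HasShortDecomposition (I.extConfSumWC k) (I.targetSumWC k)
      (decompositionBound.eval (I.len + bitLen k)) := by
  refine ⟨fun h => (h.hasShortDecomposition hm).mono ?_, sumWCYes_of_hasShortDecomposition⟩
  rw [eval_decompositionBound]
  have := vecLen_targetSumWC_le (I := I) k
  gcongr
  nlinarith

/-- Choosing `k'` as the exact cost leaves no slack to place, so no machine need exist, and keeps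
the target vector short. -/
theorem sumWCYes_iff_exists_hasShortDecomposition (k : ℕ) : I.SumWCYes k ↔
    ∃ k' ≤ k, HasShortDecomposition (I.extConfSumWC k') (I.targetSumWC k')
      (decompositionBound.eval I.len) := by
  constructor
  · intro h
    obtain ⟨c, hn, hk⟩ := (sumWCYes_iff k).1 h
    refine ⟨_, hk, (hasShortDecomposition_sumWC hn (fun _ => le_rfl) rfl).mono ?_⟩
    rw [eval_decompositionBound]
    have h₁ := vecLen_targetSumWC_le (I := I) (∑ μ, I.smithCost μ.1 (c μ))
    have h₂ := bitLen_sum_smithCost_le hn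
    gcongr
    omega
  · rintro ⟨k', hk, h⟩
    exact (sumWCYes_of_hasShortDecomposition h).mono hk

end HMInstance

/-! ### Verifiers -/

namespace RAM.Term

variable {X Y : ℕ → ℕ} {ρ : ℕ → ℕ}

/-- A term is read as a condition that holds if its value is nonzero. -/
def Holds (X Y ρ : ℕ → ℕ) (t : Term) : Prop := t.eval X Y ρ ≠ 0

/-- The condition `t₁ ≤ t₂`. -/
def le (t₁ t₂ : Term) : Term := sub (const 1) (sub t₁ t₂)

/-- The implication from `t₁` to `t₂`. -/
def imp (t₁ t₂ : Term) : Term := sub (const 1) (mul t₁ (sub (const 1) t₂))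

/-- The condition that `t` holds for all values of `v` below the total input length. -/
def all (v : ℕ) (t : Term) : Term := le (sum v (sub (const 1) t)) (const 0)

/-- `t` if `t₁ < t₂`, and zero otherwise. -/
def ifLt (t₁ t₂ t : Term) : Term := mul (sub (const 1) (sub (const 1) (sub t₂ t₁))) t

/-- `t` if `t₁ = t₂`, and zero otherwise. -/
def ifEq (t₁ t₂ t : Term) : Term := mul (sub (const 1) (add (sub t₁ t₂) (sub t₂ t₁))) t

theorem holds_le {t₁ t₂ : Term} : (le t₁ t₂).Holds X Y ρ ↔ t₁.eval X Y ρ ≤ t₂.eval X Y ρ := by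
  simp only [Holds, le, eval]
  omega

theorem holds_mul {t₁ t₂ : Term} :
    (mul t₁ t₂).Holds X Y ρ ↔ t₁.Holds X Y ρ ∧ t₂.Holds X Y ρ := by
  simp only [Holds, eval]
  exact mul_ne_zero_iff

theorem holds_sub {t₁ t₂ : Term} : (sub t₁ t₂).Holds X Y ρ ↔ t₂.eval X Y ρ < t₁.eval X Y ρ := by
  simp only [Holds, eval]
  omega

theorem holds_imp {t₁ t₂ : Term} :
    (imp t₁ t₂).Holds X Y ρ ↔ (t₁.Holds X Y ρ → t₂.Holds X Y ρ) := by
  simp only [Holds, imp, eval]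
  rcases Nat.eq_zero_or_pos (t₁.eval X Y ρ) with h₁ | h₁ <;>
    rcases Nat.eq_zero_or_pos (t₂.eval X Y ρ) with h₂ | h₂
  · simp [h₁]
  · simp [h₁]
  · simp [h₂]
    omega
  · have : 1 - t₂.eval X Y ρ = 0 := by omega
    simp [this, h₂.ne']

theorem holds_all {v : ℕ} {t : Term} :
    (all v t).Holds X Y ρ ↔ ∀ u < X 0 + Y 0, t.Holds X Y (Function.update ρ v u) := by
  rw [all, holds_le]
  simp only [eval, Nat.le_zero, Finset.sum_eq_zero_iff, Finset.mem_range, Holds]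
  refine forall₂_congr fun u _ => ?_
  omega

theorem eval_ifLt {t₁ t₂ t : Term} : (ifLt t₁ t₂ t).eval X Y ρ =
    if t₁.eval X Y ρ < t₂.eval X Y ρ then t.eval X Y ρ else 0 := by
  simp only [ifLt, eval]
  split_ifs with h
  · rw [show 1 - (1 - (t₂.eval X Y ρ - t₁.eval X Y ρ)) = 1 by omega, one_mul]
  · rw [show 1 - (1 - (t₂.eval X Y ρ - t₁.eval X Y ρ)) = 0 by omega, zero_mul]

theorem eval_ifEq {t₁ t₂ t : Term} : (ifEq t₁ t₂ t).eval X Y ρ =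
    if t₁.eval X Y ρ = t₂.eval X Y ρ then t.eval X Y ρ else 0 := by
  simp only [ifEq, eval]
  split_ifs with h
  · rw [h, Nat.sub_self, add_zero, Nat.sub_zero, one_mul]
  · rw [show 1 - (t₁.eval X Y ρ - t₂.eval X Y ρ + (t₂.eval X Y ρ - t₁.eval X Y ρ)) = 0 by omega,
      zero_mul]

end RAM.Term

namespace HMInstance

open RAM (Term)

/-! #### The cells of an encoded instance -/

theorem length_flatten_ofFn {a b : ℕ} (f : Fin a → Fin b → ℕ) :
    (List.ofFn fun i => List.ofFn (f i)).flatten.length = a * b := by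
  simp [List.length_flatten, List.map_ofFn, Function.comp_def]

theorem mul_add_lt_mul {a b : ℕ} (i : Fin a) (j : Fin b) : (i : ℕ) * b + j < a * b := by
  have := Nat.mul_le_mul_right b (Nat.succ_le_of_lt i.2)
  rw [Nat.succ_mul] at this
  omega

theorem divNat_mul_add {a b : ℕ} (i : Fin a) (j : Fin b) (h : (i : ℕ) * b + j < a * b) :
    Fin.divNat ⟨i * b + j, h⟩ = i := by
  ext
  change ((i : ℕ) * b + j) / b = i
  rw [mul_comm, Nat.mul_add_div ((Nat.zero_le _).trans_lt j.2),
    Nat.div_eq_of_lt j.2, add_zero]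

theorem modNat_mul_add {a b : ℕ} (i : Fin a) (j : Fin b) (h : (i : ℕ) * b + j < a * b) :
    Fin.modNat ⟨i * b + j, h⟩ = j := by
  ext
  change ((i : ℕ) * b + j) % b = j
  rw [mul_comm, Nat.mul_add_mod, Nat.mod_eq_of_lt j.2]

theorem flatten_ofFn_getD {a b : ℕ} (f : Fin a → Fin b → ℕ) (i : Fin a) (j : Fin b) :
    (List.ofFn fun i => List.ofFn (f i)).flatten.getD (i * b + j) 0 = f i j := by
  have h : (List.ofFn fun i => List.ofFn (f i)).flatten =
      List.ofFn fun t : Fin (a * b) => f t.divNat t.modNat := by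
    rw [List.ofFn_mul]
    simp only [divNat_mul_add, modNat_mul_add]
  rw [h, List.getD_eq_getElem _ _ (by simpa using mul_add_lt_mul i j), List.getElem_ofFn]
  simp only [divNat_mul_add, modNat_mul_add]

theorem ofFn_getD {a : ℕ} (f : Fin a → ℕ) (i : Fin a) : (List.ofFn f).getD i 0 = f i := by
  rw [List.getD_eq_getElem _ _ (by simp), List.getElem_ofFn]

theorem getD_append_add (l l' : List ℕ) {t u : ℕ} (h : t = l.length + u) :
    (l ++ l').getD t 0 = l'.getD u 0 := by
  subst h
  rw [List.getD_append_right _ _ _ _ (by omega), Nat.add_sub_cancel_left]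

section Encode

variable (I : HMInstance) (k : ℕ)

theorem length_encode :
    (I.encode k).length = 3 + 2 * I.τ + I.κ + I.κ * I.τ := by
  simp only [encode, List.length_append, List.length_ofFn, length_flatten_ofFn, List.length_cons,
    List.length_nil]
  ring

theorem listCells_encode_zero :
    RAM.listCells (I.encode k) 0 = 3 + 2 * I.τ + I.κ + I.κ * I.τ := I.length_encode k

theorem listCells_encode_one : RAM.listCells (I.encode k) 1 = I.τ := by
  simp [RAM.listCells, encode]

theorem listCells_encode_two : RAM.listCells (I.encode k) 2 = I.κ := by
  simp [RAM.listCells, encode]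

theorem listCells_succ (x : List ℕ) (t : ℕ) : RAM.listCells x (t + 1) = x.getD t 0 := rfl

theorem listCells_encode_n (j : Fin I.τ) : RAM.listCells (I.encode k) (3 + j) = I.n j := by
  rw [show 3 + (j : ℕ) = 2 + j + 1 by omega, listCells_succ, encode]
  simp only [List.append_assoc]
  rw [getD_append_add _ _ (u := j) (by simp), List.getD_append _ _ _ _ (by simp), ofFn_getD]

theorem listCells_encode_m (i : Fin I.κ) :
    RAM.listCells (I.encode k) (3 + I.τ + i) = I.m i := by
  rw [show 3 + I.τ + (i : ℕ) = 2 + I.τ + i + 1 by omega, listCells_succ, encode]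
  simp only [List.append_assoc]
  rw [getD_append_add _ _ (u := I.τ + i) (by simp; omega), getD_append_add _ _ (u := i) (by simp),
    List.getD_append _ _ _ _ (by simp), ofFn_getD]

theorem listCells_encode_p (i : Fin I.κ) (j : Fin I.τ) :
    RAM.listCells (I.encode k) (3 + I.τ + I.κ + (i * I.τ + j)) = I.p i j := by
  rw [show 3 + I.τ + I.κ + (i * I.τ + (j : ℕ)) = 2 + I.τ + I.κ + (i * I.τ + j) + 1 by omega,
    listCells_succ, encode]
  have hlt := mul_add_lt_mul i j
  simp only [List.append_assoc]
  rw [getD_append_add _ _ (u := I.τ + (I.κ + (i * I.τ + j))) (by simp; omega),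
    getD_append_add _ _ (u := I.κ + (i * I.τ + j)) (by simp),
    getD_append_add _ _ (u := i * I.τ + j) (by simp),
    List.getD_append _ _ _ _ (by rwa [length_flatten_ofFn]), flatten_ofFn_getD]

theorem listCells_encode_w (j : Fin I.τ) :
    RAM.listCells (I.encode k) (3 + I.τ + I.κ + I.κ * I.τ + j) = I.w j := by
  rw [show 3 + I.τ + I.κ + I.κ * I.τ + (j : ℕ) = 2 + I.τ + I.κ + I.κ * I.τ + j + 1 by omega,
    listCells_succ, encode]
  simp only [List.append_assoc]
  rw [getD_append_add _ _ (u := I.τ + (I.κ + (I.κ * I.τ + j))) (by simp; omega),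
    getD_append_add _ _ (u := I.κ + (I.κ * I.τ + j)) (by simp),
    getD_append_add _ _ (u := I.κ * I.τ + j) (by simp),
    getD_append_add _ _ (u := j) (by rw [length_flatten_ofFn]),
    List.getD_append _ _ _ _ (by simp), ofFn_getD]

theorem listCells_encode_k :
    RAM.listCells (I.encode k) (3 + I.τ + I.κ + I.κ * I.τ + I.τ) = k := by
  rw [show 3 + I.τ + I.κ + I.κ * I.τ + I.τ = 2 + I.τ + I.κ + I.κ * I.τ + I.τ + 1 by omega,
    listCells_succ, encode, getD_append_add _ _ (u := 0)]
  · simp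
  · simp only [List.length_append, List.length_ofFn, length_flatten_ofFn, List.length_cons,
      List.length_nil]
    ring

end Encode

/-- A list of the right length encodes an instance. -/
theorem exists_encode_eq {x : List ℕ} (h : RAM.listCells x 0 = 3 + 2 * RAM.listCells x 1 +
      RAM.listCells x 2 + RAM.listCells x 2 * RAM.listCells x 1) :
    ∃ (I : HMInstance) (k : ℕ), x = I.encode k := by
  set τ := RAM.listCells x 1
  set κ := RAM.listCells x 2
  -- The entries are arbitrary natural numbers, so the cells define an instance with no further
  -- conditions.
  let I : HMInstance :=
    { τ := τ
      κ := κ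
      n := fun j => RAM.listCells x (3 + j)
      m := fun i => RAM.listCells x (3 + τ + i)
      p := fun i j => RAM.listCells x (3 + τ + κ + (i * τ + j))
      w := fun j => RAM.listCells x (3 + τ + κ + κ * τ + j) }
  let k := RAM.listCells x (3 + τ + κ + κ * τ + τ)
  have hcell : ∀ t < 3 + 2 * τ + κ + κ * τ,
      RAM.listCells x (t + 1) = RAM.listCells (I.encode k) (t + 1) := by
    intro t ht
    rcases lt_or_ge t 2 with h | h
    · interval_cases t
      · exact (I.listCells_encode_one k).symm
      · exact (I.listCells_encode_two k).symm
    obtain ⟨t, rfl⟩ := Nat.exists_eq_add_of_le h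
    rcases lt_or_ge t τ with h | h
    · rw [show 2 + t + 1 = 3 + t by omega]
      exact (I.listCells_encode_n k ⟨t, h⟩).symm
    obtain ⟨t, rfl⟩ := Nat.exists_eq_add_of_le h
    rcases lt_or_ge t κ with h | h
    · rw [show 2 + (τ + t) + 1 = 3 + τ + t by omega]
      exact (I.listCells_encode_m k ⟨t, h⟩).symm
    obtain ⟨t, rfl⟩ := Nat.exists_eq_add_of_le h
    rcases lt_or_ge t (κ * τ) with h | h
    · rw [show 2 + (τ + (κ + t)) + 1 = 3 + τ + κ + t by omega]
      -- The block of processing times is stored row by row, so its addresses split by quotient and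
      -- remainder modulo `τ`; the block is nonempty here.
      have hτ : 0 < τ := Nat.pos_of_ne_zero fun h0 => by simp [h0] at h
      have := I.listCells_encode_p k ⟨t / τ, (Nat.div_lt_iff_lt_mul hτ).2 h⟩ ⟨t % τ, Nat.mod_lt _ hτ⟩
      have ht : t / τ * τ + t % τ = t := Nat.div_add_mod' t τ
      simp only [I, ht] at this
      exact this.symm
    obtain ⟨t, rfl⟩ := Nat.exists_eq_add_of_le h
    rcases lt_or_ge t τ with h | h
    · rw [show 2 + (τ + (κ + (κ * τ + t))) + 1 = 3 + τ + κ + κ * τ + t by omega]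
      exact (I.listCells_encode_w k ⟨t, h⟩).symm
    obtain rfl : t = τ := by omega
    rw [show 2 + (τ + (κ + (κ * τ + τ))) + 1 = 3 + τ + κ + κ * τ + τ by omega]
    exact (I.listCells_encode_k k).symm
  have hx : x.length = 3 + 2 * τ + κ + κ * τ := h
  refine ⟨I, k, List.ext_getElem (hx.trans (I.length_encode k).symm) fun t h₁ h₂ => ?_⟩
  have := hcell t (hx ▸ h₁)
  rwa [listCells_succ, listCells_succ, List.getD_eq_getElem _ _ h₁,
    List.getD_eq_getElem _ _ h₂] at this

/-! #### Terms for the data of an instance and of a certificate -/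

/-- The number of job types. -/
def tauT : Term := .fst (.const 1)

/-- The number of machine kinds. -/
def kappaT : Term := .fst (.const 2)

/-- The number of jobs of a type. -/
def nT (j : Term) : Term := .fst (.add (.const 3) j)

/-- The number of machines of a kind. -/
def mT (i : Term) : Term := .fst (.add (.add (.const 3) tauT) i)

/-- The processing time of a job type on a machine kind. -/
def pT (i j : Term) : Term :=
  .fst (.add (.add (.add (.const 3) tauT) kappaT) (.add (.mul i tauT) j))

/-- The address behind the processing times. -/
def offsetT : Term := .add (.add (.add (.const 3) tauT) kappaT) (.mul kappaT tauT)

/-- The weight of a job type. -/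
def wT (j : Term) : Term := .fst (.add offsetT j)

/-- The bound of the decision problem. -/
def kT : Term := .fst (.add offsetT tauT)

/-- The address of row `s` of a certificate, for `s` the variable `0`. -/
def rowT : Term := .add (.const 1) (.mul (.var 0) (.add tauT (.const 2)))

/-- The machine kind of row `s`. -/
def kindT : Term := .snd rowT

/-- The multiplicity of row `s`. -/
def multT : Term := .snd (.add rowT (.const 1))

/-- The entry for a job type in the configuration of row `s`. -/
def confT (j : Term) : Term := .snd (.add rowT (.add (.const 2) j))

/-- The sum over all job types. -/
def sumTypesT (v : ℕ) (t : Term) : Term := .sum v (.ifLt (.var v) tauT t)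

/-- The equation of two numbers. -/
def eqT (t₁ t₂ : Term) : Term := .mul (.le t₁ t₂) (.le t₂ t₁)

/-- The condition that the length of the input fits its first two entries. -/
def shapeT : Term := eqT (.fst (.const 0))
  (.add (.add (.add (.const 3) (.mul (.const 2) tauT)) kappaT) (.mul kappaT tauT))

/-- The condition that the rows of the certificate cover all machines and jobs. -/
def coversT : Term :=
  .mul (.all 0 (.imp multT (.sub kappaT kindT))) <|
  .mul (.all 1 (.imp (.sub kappaT (.var 1))
    (eqT (.sum 0 (.ifEq kindT (.var 1) multT)) (mT (.var 1)))))
  (.all 1 (.imp (.sub tauT (.var 1))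
    (eqT (.sum 0 (.mul multT (confT (.var 1)))) (nT (.var 1)))))

/-- The minimum of two numbers. -/
def minT (t₁ t₂ : Term) : Term := .sub t₁ (.sub t₁ t₂)

/-- Twice the value of the configuration of row `s`. -/
def twiceCostT : Term := .add
  (sumTypesT 1 (.mul (confT (.var 1)) (.mul (wT (.var 1)) (pT kindT (.var 1)))))
  (sumTypesT 1 (.mul (confT (.var 1)) (sumTypesT 2 (.mul (confT (.var 2))
    (minT (.mul (wT (.var 1)) (pT kindT (.var 2))) (.mul (wT (.var 2)) (pT kindT (.var 1))))))))

/-- The verifier for `C_max`. -/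
def cmaxT : Term := .mul shapeT <| .mul coversT <|
  .all 0 (.imp multT (.le (sumTypesT 1 (.mul (pT kindT (.var 1)) (confT (.var 1)))) kT))

/-- The verifier for `∑ w_j C_j`. -/
def sumWCT : Term := .mul shapeT <| .mul coversT <|
  .le (.sum 0 (.mul multT twiceCostT)) (.mul (.const 2) kT)

section Semantics

variable {X Y ρ : ℕ → ℕ}

theorem holds_eqT {t₁ t₂ : Term} : (eqT t₁ t₂).Holds X Y ρ ↔ t₁.eval X Y ρ = t₂.eval X Y ρ := by
  rw [eqT, Term.holds_mul, Term.holds_le, Term.holds_le, le_antisymm_iff]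

theorem eval_minT {t₁ t₂ : Term} :
    (minT t₁ t₂).eval X Y ρ = min (t₁.eval X Y ρ) (t₂.eval X Y ρ) := by
  simp only [minT, Term.eval]
  omega

/-- The built-in sum runs up to the total input length; `hX` ensures that this range includes all
job types, and the conditional cuts off the rest. -/
theorem eval_sumTypesT {v : ℕ} {t : Term} (hX : X 1 ≤ X 0) : (sumTypesT v t).eval X Y ρ =
    ∑ u ∈ Finset.range (X 1), t.eval X Y (Function.update ρ v u) := by
  simp only [sumTypesT, Term.eval, Term.eval_ifLt, tauT, Function.update_self]
  rw [← Finset.sum_filter]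
  congr 1
  ext u
  simp only [Finset.mem_filter, Finset.mem_range]
  omega

/-- The machine kind in row `s` of a certificate. -/
def rowKind (Y : ℕ → ℕ) (τ s : ℕ) : ℕ := Y (1 + s * (τ + 2))

/-- The multiplicity in row `s` of a certificate. -/
def rowMult (Y : ℕ → ℕ) (τ s : ℕ) : ℕ := Y (1 + s * (τ + 2) + 1)

/-- The configuration in row `s` of a certificate. -/
def rowConf (Y : ℕ → ℕ) (τ s : ℕ) (j : Fin τ) : ℕ := Y (1 + s * (τ + 2) + (2 + j))

theorem holds_shapeT : shapeT.Holds X Y ρ ↔ X 0 = 3 + 2 * X 1 + X 2 + X 2 * X 1 := by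
  simp only [shapeT, holds_eqT, Term.eval, tauT, kappaT]

variable (I : HMInstance) (k : ℕ)

/-- The verifier does not know the number of rows and runs `s` up to the total input length. Surplus
rows are harmless when their multiplicity is zero, which is why `Covers` restricts the kind only for
nonzero multiplicities. -/
theorem holds_coversT :
    coversT.Holds (RAM.listCells (I.encode k)) Y ρ ↔
      I.Covers ((I.encode k).length + Y 0) (rowKind Y I.τ) (rowMult Y I.τ) (rowConf Y I.τ) := by
  have h0 : RAM.listCells (I.encode k) 0 = (I.encode k).length := rfl
  have hτ : I.τ ≤ (I.encode k).length := by rw [length_encode]; omega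
  have hκ : I.κ ≤ (I.encode k).length := by rw [length_encode]; omega
  simp only [coversT, Term.holds_mul, Term.holds_all, Term.holds_imp, holds_eqT, Term.holds_sub,
    Term.eval, Term.eval_ifEq, Covers]
  simp only [multT, kindT, confT, rowT, mT, nT, tauT, kappaT, Term.eval, Term.Holds,
    Function.update_self, ne_eq, one_ne_zero, not_false_eq_true,
    Function.update_of_ne, listCells_encode_one, listCells_encode_two, h0]
  refine and_congr Iff.rfl (and_congr ?_ ?_)
  · refine ⟨fun h i => ?_, fun h u _ hu => ?_⟩
    · have := h i (by omega) i.2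
      rwa [listCells_encode_m] at this
    · have := h ⟨u, hu⟩
      rw [← I.listCells_encode_m k] at this
      exact this
  · refine ⟨fun h i => ?_, fun h u _ hu => ?_⟩
    · have := h i (by omega) i.2
      rwa [listCells_encode_n] at this
    · have := h ⟨u, hu⟩
      rw [← I.listCells_encode_n k] at this
      exact this

theorem eval_twiceCostT (s : ℕ) (i : Fin I.κ) (hi : rowKind Y I.τ s = i) :
    twiceCostT.eval (RAM.listCells (I.encode k)) Y (Function.update ρ 0 s) =
      I.twiceCost i (rowConf Y I.τ s) := by
  have hX : RAM.listCells (I.encode k) 1 ≤ RAM.listCells (I.encode k) 0 := by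
    rw [listCells_encode_zero, listCells_encode_one]
    omega
  rw [rowKind] at hi
  simp only [twiceCostT, Term.eval, eval_sumTypesT hX, eval_minT]
  simp only [kindT, confT, rowT, wT, pT, offsetT, tauT, kappaT, Term.eval,
    Function.update_self, ne_eq, zero_ne_one, not_false_eq_true, OfNat.zero_ne_ofNat,
    OfNat.one_ne_ofNat,
    Function.update_of_ne, listCells_encode_one, listCells_encode_two, Finset.sum_range, hi,
    listCells_encode_w, listCells_encode_p]
  rfl

theorem eval_sum_pT (s : ℕ) (i : Fin I.κ) (hi : rowKind Y I.τ s = i) :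
    (sumTypesT 1 (.mul (pT kindT (.var 1)) (confT (.var 1)))).eval
      (RAM.listCells (I.encode k)) Y (Function.update ρ 0 s) =
      ∑ j, I.p i j * rowConf Y I.τ s j := by
  have hX : RAM.listCells (I.encode k) 1 ≤ RAM.listCells (I.encode k) 0 := by
    rw [listCells_encode_zero, listCells_encode_one]
    omega
  rw [rowKind] at hi
  simp only [Term.eval, eval_sumTypesT hX]
  simp only [kindT, confT, rowT, pT, tauT, kappaT, Term.eval,
    Function.update_self, ne_eq, zero_ne_one, not_false_eq_true,
    Function.update_of_ne, listCells_encode_one, listCells_encode_two, Finset.sum_range, hi,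
    listCells_encode_p]
  rfl

theorem eval_kT : kT.eval (RAM.listCells (I.encode k)) Y ρ = k := by
  simp only [kT, offsetT, tauT, kappaT, Term.eval, listCells_encode_one, listCells_encode_two,
    listCells_encode_k]

theorem eval_multT (s : ℕ) :
    multT.eval (RAM.listCells (I.encode k)) Y (Function.update ρ 0 s) = rowMult Y I.τ s := by
  simp only [multT, rowT, tauT, Term.eval, listCells_encode_one, Function.update_self, rowMult]

theorem holds_cmaxT : cmaxT.Holds (RAM.listCells (I.encode k)) Y ρ ↔
    I.Covers ((I.encode k).length + Y 0) (rowKind Y I.τ) (rowMult Y I.τ) (rowConf Y I.τ) ∧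
      ∀ s < (I.encode k).length + Y 0, rowMult Y I.τ s ≠ 0 → ∀ i : Fin I.κ, rowKind Y I.τ s = i →
        ∑ j, I.p i j * rowConf Y I.τ s j ≤ k := by
  rw [cmaxT, Term.holds_mul, Term.holds_mul, holds_coversT, holds_shapeT, listCells_encode_zero,
    listCells_encode_one, listCells_encode_two, Term.holds_all]
  simp only [true_and]
  -- The covering condition is needed for the second conjunct: it guarantees that the kind of a used
  -- row is a valid address for processing times.
  refine and_congr_right fun hc => forall₂_congr fun s hs => ?_
  rw [Term.holds_imp, Term.holds_le, Term.Holds, eval_multT, eval_kT]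
  refine forall_congr' fun hl => ?_
  have hi := hc.1 s hs hl
  rw [eval_sum_pT I k s ⟨_, hi⟩ rfl]
  refine ⟨fun h i hi' => ?_, fun h => h _ rfl⟩
  obtain rfl : (⟨_, hi⟩ : Fin I.κ) = i := Fin.ext hi'
  exact h

/-- The cost term stays unevaluated: in a row of multiplicity zero the kind may be out of range, and
the value read there is then multiplied by zero. -/
theorem holds_sumWCT : sumWCT.Holds (RAM.listCells (I.encode k)) Y ρ ↔
    I.Covers ((I.encode k).length + Y 0) (rowKind Y I.τ) (rowMult Y I.τ) (rowConf Y I.τ) ∧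
      ∑ s ∈ Finset.range ((I.encode k).length + Y 0), rowMult Y I.τ s *
        twiceCostT.eval (RAM.listCells (I.encode k)) Y (Function.update ρ 0 s) ≤ 2 * k := by
  rw [sumWCT, Term.holds_mul, Term.holds_mul, holds_coversT, holds_shapeT, listCells_encode_zero,
    listCells_encode_one, listCells_encode_two, Term.holds_le]
  simp only [true_and, Term.eval, eval_multT, eval_kT]
  rfl

end Semantics

/-! #### Certificates -/

/-- The certificate with given rows. -/
def certificate (τ r : ℕ) (kind l : ℕ → ℕ) (c : ℕ → Fin τ → ℕ) : List ℕ :=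
  (List.ofFn fun s : Fin r => List.ofFn fun u : Fin (τ + 2) =>
    (Fin.cons (kind s) (Fin.cons (l s) (c s)) : Fin (τ + 2) → ℕ) u).flatten

section Certificate

variable {τ r : ℕ} {kind l : ℕ → ℕ} {c : ℕ → Fin τ → ℕ}

theorem length_certificate : (certificate τ r kind l c).length = r * (τ + 2) :=
  length_flatten_ofFn _

theorem listCells_certificate {s : ℕ} (hs : s < r) (u : Fin (τ + 2)) :
    RAM.listCells (certificate τ r kind l c) (1 + s * (τ + 2) + u) =
      (Fin.cons (kind s) (Fin.cons (l s) (c s)) : Fin (τ + 2) → ℕ) u := by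
  rw [show 1 + s * (τ + 2) + (u : ℕ) = s * (τ + 2) + u + 1 by omega, listCells_succ]
  exact flatten_ofFn_getD (fun s : Fin r => (Fin.cons (kind s) (Fin.cons (l s) (c s)) :
    Fin (τ + 2) → ℕ)) ⟨s, hs⟩ u

theorem rowKind_certificate {s : ℕ} (hs : s < r) :
    rowKind (RAM.listCells (certificate τ r kind l c)) τ s = kind s :=
  listCells_certificate hs 0

theorem rowMult_certificate {s : ℕ} (hs : s < r) :
    rowMult (RAM.listCells (certificate τ r kind l c)) τ s = l s :=
  listCells_certificate hs (Fin.succ 0)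

theorem rowConf_certificate {s : ℕ} (hs : s < r) :
    rowConf (RAM.listCells (certificate τ r kind l c)) τ s = c s := by
  ext j
  rw [rowConf, show 2 + (j : ℕ) = (j.succ.succ : Fin (τ + 2)) by simp; omega,
    listCells_certificate hs]
  simp

/-- Beyond its entries, the certificate array reads as zero, so nonexistent rows have multiplicity
zero. -/
theorem rowMult_certificate_of_le {s : ℕ} (hs : r ≤ s) :
    rowMult (RAM.listCells (certificate τ r kind l c)) τ s = 0 := by
  rw [rowMult, listCells_succ, List.getD_eq_default]
  rw [length_certificate]
  have := Nat.mul_le_mul_right (τ + 2) hs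
  omega

theorem listLen_flatten_ofFn {a b B : ℕ} {f : Fin a → Fin b → ℕ} (h : ∀ i j, bitLen (f i j) ≤ B) :
    listLen (List.ofFn fun i => List.ofFn (f i)).flatten ≤ a * b * B := by
  have hle : ∀ t ∈ ((List.ofFn fun i => List.ofFn (f i)).flatten.map bitLen), t ≤ B := by
    intro t ht
    simp only [List.mem_map, List.mem_flatten, List.mem_ofFn] at ht
    obtain ⟨_, ⟨_, ⟨i, rfl⟩, hj⟩, rfl⟩ := ht
    obtain ⟨j, rfl⟩ := List.mem_ofFn.1 hj
    exact h i j
  have := List.sum_le_card_nsmul _ B hle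
  rwa [List.length_map, length_flatten_ofFn, smul_eq_mul] at this

theorem listLen_certificate_le {B : ℕ} (hk : ∀ s < r, bitLen (kind s) ≤ B)
    (hl : ∀ s < r, bitLen (l s) ≤ B) (hc : ∀ s < r, ∀ j, bitLen (c s j) ≤ B) :
    listLen (certificate τ r kind l c) ≤ r * (τ + 2) * B := by
  refine listLen_flatten_ofFn fun s u => ?_
  refine Fin.cases ?_ (fun u => ?_) u
  · simpa using hk s s.2
  · refine Fin.cases ?_ (fun j => ?_) u
    · simpa using hl s s.2
    · simpa using hc s s.2 j

theorem le_listCells_certificate_zero : r ≤ RAM.listCells (certificate τ r kind l c) 0 := by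
  have : RAM.listCells (certificate τ r kind l c) 0 = r * (τ + 2) := length_certificate
  rw [this]
  exact Nat.le_mul_of_pos_right _ (by omega)

theorem sum_rowMult_certificate {L : ℕ} (hL : r ≤ L) {F G : ℕ → ℕ} (h : ∀ s < r, F s = G s) :
    ∑ s ∈ Finset.range L, rowMult (RAM.listCells (certificate τ r kind l c)) τ s * F s =
      ∑ s ∈ Finset.range r, l s * G s := by
  rw [← Finset.sum_subset (Finset.range_mono hL)]
  · refine Finset.sum_congr rfl fun s hs => ?_
    rw [rowMult_certificate (Finset.mem_range.1 hs), h s (Finset.mem_range.1 hs)]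
  · intro s _ hs
    rw [rowMult_certificate_of_le (by simpa using hs), zero_mul]

end Certificate

theorem Covers.certificate {I : HMInstance} {r L : ℕ} {kind l : ℕ → ℕ} {c : ℕ → Fin I.τ → ℕ}
    (h : I.Covers r kind l c) (hL : r ≤ L) :
    I.Covers L (rowKind (RAM.listCells (certificate I.τ r kind l c)) I.τ)
      (rowMult (RAM.listCells (certificate I.τ r kind l c)) I.τ)
      (rowConf (RAM.listCells (certificate I.τ r kind l c)) I.τ) := by
  refine ⟨fun s _ hl => ?_, fun i => ?_, fun j => ?_⟩
  · rcases lt_or_ge s r with hs | hs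
    · rw [rowMult_certificate hs] at hl
      rw [rowKind_certificate hs]
      exact h.1 s hs hl
    · exact absurd (rowMult_certificate_of_le hs) hl
  · have := sum_rowMult_certificate (τ := I.τ) (kind := kind) (l := l) (c := c) hL
      (F := fun s => if rowKind (RAM.listCells (HMInstance.certificate I.τ r kind l c)) I.τ s = i
        then 1 else 0) (G := fun s => if kind s = i then 1 else 0)
      fun s hs => by rw [rowKind_certificate hs]
    simp only [mul_ite, mul_one, mul_zero] at this
    rw [this, h.2.1 i]
  · rw [sum_rowMult_certificate hL (G := fun s => c s j) fun s hs => by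
      rw [rowConf_certificate hs], h.2.2 j]

theorem listLen_append (x y : List ℕ) : listLen (x ++ y) = listLen x + listLen y := by
  simp [listLen]

theorem listLen_ofFn {a : ℕ} (f : Fin a → ℕ) : listLen (List.ofFn f) = vecLen f := by
  simp [listLen, vecLen, List.map_ofFn, List.sum_ofFn]

theorem listLen_encode (I : HMInstance) (k : ℕ) :
    listLen (I.encode k) = bitLen I.τ + bitLen I.κ + I.len + bitLen k := by
  have h : listLen (List.ofFn fun i => List.ofFn (I.p i)).flatten = ∑ i, vecLen (I.p i) := by
    simp only [← listLen_ofFn]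
    simp [listLen, List.map_flatten, List.sum_flatten, List.map_ofFn, List.sum_ofFn,
      Function.comp_def]
  simp only [encode, listLen_append, listLen_ofFn, h, len]
  simp only [listLen, List.map_cons, List.map_nil, List.sum_cons, List.sum_nil]
  omega

/-- The polynomial that bounds the lengths of certificates. -/
noncomputable def certificateBound : Polynomial ℕ :=
  Polynomial.X * (Polynomial.X + 2) * (2 * Polynomial.X ^ 2 + Polynomial.X)

/-- There are at most `V` rows of `τ + 2` entries each. The bound `2 * V ^ 2` from the decomposition
covers multiplicities and configurations; the extra `N` in the entry bound covers the kinds, since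
`κ ≤ N`. -/
theorem listLen_certificate_le_eval {I : HMInstance} {k r V : ℕ} {kind l : ℕ → ℕ}
    {c : ℕ → Fin I.τ → ℕ} (hr : r ≤ V) (hV : V ≤ listLen (I.encode k))
    (h : ∀ s < r, kind s < I.κ ∧ bitLen (l s) ≤ 2 * V ^ 2 ∧ ∀ j, bitLen (c s j) ≤ 2 * V ^ 2) :
    listLen (certificate I.τ r kind l c) ≤ certificateBound.eval (listLen (I.encode k)) := by
  have hN := length_le_listLen (I.encode k)
  rw [length_encode] at hN
  set N := listLen (I.encode k)
  have hB : 2 * V ^ 2 ≤ 2 * N ^ 2 + N :=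
    (Nat.mul_le_mul_left 2 (Nat.pow_le_pow_left hV 2)).trans (Nat.le_add_right _ _)
  refine (listLen_certificate_le (B := 2 * N ^ 2 + N) (fun s hs => ?_)
    (fun s hs => (h s hs).2.1.trans hB) fun s hs j => ((h s hs).2.2 j).trans hB).trans ?_
  · have h₁ := bitLen_le_succ (kind s)
    have h₂ := (h s hs).1
    omega
  · simp only [certificateBound, Polynomial.eval_mul, Polynomial.eval_add, Polynomial.eval_X,
      Polynomial.eval_pow, Polynomial.eval_ofNat]
    exact Nat.mul_le_mul_right _ (Nat.mul_le_mul (hr.trans hV) (by omega))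

/-! ### Membership in NP -/

theorem cmaxProblem_inNP : InNP CmaxProblem := by
  refine InNP.of_term cmaxT certificateBound (fun x y h => ?_) ?_
  · obtain ⟨I, k, rfl⟩ := exists_encode_eq (holds_shapeT.1 (Term.holds_mul.1 h).1)
    obtain ⟨hc, hk⟩ := (holds_cmaxT I k).1 h
    exact ⟨I, k, rfl, hc.cmaxYes hk⟩
  · rintro _ ⟨I, k, rfl, h⟩
    obtain ⟨r, kind, l, c, hr, hc, hk, hB⟩ := exists_covers_of_cmax h.hasShortDecomposition
    refine ⟨certificate I.τ r kind l c, listLen_certificate_le_eval hr ?_ hB,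
      (holds_cmaxT I k).2 ⟨hc.certificate ?_, fun s _ hl i hi => ?_⟩⟩
    · have := vecLen_targetCmax_le (I := I)
      rw [listLen_encode]
      omega
    · exact le_listCells_certificate_zero.trans (Nat.le_add_left _ _)
    · rcases lt_or_ge s r with hs | hs
      · rw [rowKind_certificate hs] at hi
        rw [rowConf_certificate hs]
        exact hk s hs i hi
      · exact absurd (rowMult_certificate_of_le hs) hl

theorem sumWCProblem_inNP : InNP SumWCProblem := by
  refine InNP.of_term sumWCT certificateBound (fun x y h => ?_) ?_
  · obtain ⟨I, k, rfl⟩ := exists_encode_eq (holds_shapeT.1 (Term.holds_mul.1 h).1)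
    obtain ⟨hc, hk⟩ := (holds_sumWCT I k).1 h
    exact ⟨I, k, rfl, hc.sumWCYes _ (fun s _ _ i hi => (eval_twiceCostT I k s i hi).ge) hk⟩
  · rintro _ ⟨I, k, rfl, h⟩
    -- The certificate comes from a decomposition for the exact cost rather than for `k`, so
    -- instances without machines need no separate treatment.
    obtain ⟨a, hn, ha⟩ := (sumWCYes_iff k).1 h
    obtain ⟨r, kind, l, c, F, hr, hc, hF, hk, hB⟩ :=
      exists_covers_of_sumWC (hasShortDecomposition_sumWC hn (fun _ => le_rfl) rfl)
    have hL := le_listCells_certificate_zero (τ := I.τ) (r := r) (kind := kind) (l := l) (c := c)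
    refine ⟨certificate I.τ r kind l c, listLen_certificate_le_eval hr ?_ hB,
      (holds_sumWCT I k).2 ⟨hc.certificate (hL.trans (Nat.le_add_left _ _)), ?_⟩⟩
    · have h₁ := vecLen_targetSumWC_le (I := I) (∑ μ, I.smithCost μ.1 (a μ))
      have h₂ := bitLen_mono ha
      rw [listLen_encode]
      omega
    · rw [sum_rowMult_certificate (hL.trans (Nat.le_add_left _ _)) fun s hs => rfl]
      refine (Finset.sum_le_sum fun s hs => Nat.mul_le_mul_left _ ?_).trans
        (hk.trans (Nat.mul_le_mul_left 2 ha))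
      have hs' := Finset.mem_range.1 hs
      rw [eval_twiceCostT I k s ⟨kind s, (hB s hs').1⟩ (rowKind_certificate hs'),
        rowConf_certificate hs']
      exact hF s hs' _ rfl

end HMInstance

theorem mainTheorem10 :
    InNP HMInstance.CmaxProblem ∧
    InNP HMInstance.SumWCProblem ∧
    ∃ q : Polynomial ℕ, ∀ (I : HMInstance) (k : ℕ),
      (I.CmaxYes k ↔
        HasShortDecomposition (I.extConfCmax k) I.targetCmax (q.eval I.len)) ∧
      ((∃ i, 0 < I.m i) →
        (I.SumWCYes k ↔
          HasShortDecomposition (I.extConfSumWC k) (I.targetSumWC k)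
            (q.eval (I.len + bitLen k)))) ∧
      (I.SumWCYes k ↔
        ∃ k' ≤ k, HasShortDecomposition (I.extConfSumWC k') (I.targetSumWC k')
          (q.eval I.len)) :=
  ⟨HMInstance.cmaxProblem_inNP, HMInstance.sumWCProblem_inNP, HMInstance.decompositionBound,
    fun _ k => ⟨HMInstance.cmaxYes_iff_hasShortDecomposition k,
      HMInstance.sumWCYes_iff_hasShortDecomposition k,
      HMInstance.sumWCYes_iff_exists_hasShortDecomposition k⟩⟩
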